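/- Let $0<d^-\leqslant d^+<\infty$ and let $p$ be fixed with $\max\{1,1/d^-\}<p\leqslant\infty$. There exist $\delta>0$ and $C>0$, depending only on $d^-$, $d^+$ and $p$, such that the following holds. Let $(d_j)_{j\geqslant 1}$ be real numbers with $d^-\leqslant d_j\leqslant d^+$ for all $j\geqslant 1$, and let $(\hat f(j))_{j\geqslant 1}$ be complex numbers. Define $p_n$ and $M_n$ for $n\geqslant 0$ by the generating functions $$ \sum_{n=0}^\infty p_nz^n=\exp\Bigl\{\sum_{j=1}^\infty\frac{d_j}{j}z^j\Bigr\},\qquad \sum_{n=0}^\infty M_nz^n=\exp\Bigl\{\sum_{j=1}^\infty\frac{d_j\hat f(j)}{j}z^j\Bigr\}, $$ put $L_N(z)=\sum_{j=1}^N d_j\frac{\hat f(j)-1}{j}z^j$, and let $$ \rho=\rho(p)=\Bigl(\sum_{j=1}^\infty\frac{|\hat f(j)-1|^p}{j}\Bigr)^{1/p}\ \text{ if } p<\infty,\qquad \rho(\infty)=\sup_{j\geqslant 1}|\hat f(j)-1|. $$ If $\rho\leqslant\delta$, then for every $N\geqslant 0$ $$ \frac{M_N}{p_N}=\exp\{L_N(1)\}\left(1+\sum_{j=1}^N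 d_j\,\frac{\hat f(j)-1}{j}\left(\frac{p_{N-j}}{p_N}-1\right)+R_N\right) \qquad\text{with}\quad |R_N|\leqslant C\rho^2 . $$ -/

import Mathlib

open Finset
open scoped ENNReal

namespace VoronoiMean

noncomputable section

/-- The formal power series `∑_{j ≥ 1} (a_j / j) z ^ j`. -/
def logSeries {K : Type*} [Field K] (a : ℕ → K) : PowerSeries K :=
  PowerSeries.mk fun j => if j = 0 then 0 else a j / (j : K)

/-- The series has constant term zero, so it may be substituted into the exponential series. -/
theorem hasSubst_logSeries {K : Type*} [Field K] (a : ℕ → K) :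
    PowerSeries.HasSubst (logSeries a) :=
  PowerSeries.HasSubst.of_constantCoeff_zero' (by
    rw [← PowerSeries.coeff_zero_eq_constantCoeff_apply]
    simp [logSeries])

/-- The coefficient `[z ^ n] exp (∑_{j ≥ 1} (a_j / j) z ^ j)`. -/
def expCoeff {K : Type*} [Field K] [CharZero K] (a : ℕ → K) (n : ℕ) : K :=
  PowerSeries.coeff n ((PowerSeries.exp K).subst (logSeries a))

/-- `p_n = [z ^ n] exp (∑_{j ≥ 1} (d_j / j) z ^ j)`. -/
def pCoeff (d : ℕ → ℝ) (n : ℕ) : ℝ :=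
  expCoeff d n

/-- `M_n = [z ^ n] exp (∑_{j ≥ 1} (d_j f̂(j) / j) z ^ j)`. -/
def mCoeff (d : ℕ → ℝ) (f : ℕ → ℂ) (n : ℕ) : ℂ :=
  expCoeff (fun j => (d j : ℂ) * f j) n

/-- `L_n(z) = ∑_{j=1}^n d_j ((f̂(j) - 1) / j) z ^ j`. -/
def lPoly (d : ℕ → ℝ) (f : ℕ → ℂ) (n : ℕ) (z : ℂ) : ℂ :=
  ∑ j ∈ Icc 1 n, (d j : ℂ) * ((f j - 1) / (j : ℂ)) * z ^ j

/-- `ρ(p) = (∑_{j ≥ 1} |f̂(j) - 1| ^ p / j) ^ (1 / p)` for finite `p`, and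
`ρ(∞) = sup_{j ≥ 1} |f̂(j) - 1|`; the value is `∞` if the series diverges or the supremum is
infinite. The summation index is shifted by one. -/
def rho (f : ℕ → ℂ) (p : ℝ≥0∞) : ℝ≥0∞ :=
  if p = ∞ then ⨆ j : ℕ, ‖f (j + 1) - 1‖ₑ
  else (∑' j : ℕ, ‖f (j + 1) - 1‖ₑ ^ p.toReal / ((j + 1 : ℕ) : ℝ≥0∞)) ^ (1 / p.toReal)

end

end VoronoiMean

/-!
Write `d_j f̂(j) = d_j + e_j` and `T_N = exp (∑_{j ≤ N} e_j / j)`. When `e` is replaced by `w • e`,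
the ratio `Φ(w) = M_N / (p_N T_N)` is an entire function of `w` with `Φ(0) = 1`, and `Φ'(0)` is the
first order term of the expansion. If `|Φ| ≤ B` on the disc `|w| ≤ δ / ρ`, then the Schwarz lemma
gives `|Φ(1) - Φ(0) - Φ'(0)| = O(ρ²)`.

The bound on `Φ` comes from a contraction. The identity `n M_n = ∑_{i < n} (d_{n-i} + e_{n-i}) M_i`
alone only bounds `X = sup_n |M_n| / (p_n |T_n|)` by `(1 + o(1)) X`. The value at radius
`r ≈ 1 - K / n` of the generating function of `M` is however known to be of order `p_n n T_n`, so a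
multiple of the Abel mean `∑_i M_i r^i` can be subtracted from the recurrence. This lowers the total
weight by a fixed factor and gives `X ≤ (1 - κ) X + O(1)`.
-/

namespace VoronoiMean

section ExpCoeff

variable {K : Type*} [Field K] [CharZero K]

theorem coeff_derivative_logSeries (a : ℕ → K) (n : ℕ) :
    PowerSeries.coeff n (PowerSeries.derivative K (logSeries a)) = a (n + 1) := by
  rw [PowerSeries.coeff_derivative, logSeries, PowerSeries.coeff_mk, if_neg n.succ_ne_zero,
    Nat.cast_succ, div_mul_cancel₀ _ n.cast_add_one_ne_zero]

theorem expCoeff_zero (a : ℕ → K) : expCoeff a 0 = 1 := by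
  rw [expCoeff, PowerSeries.coeff_subst' (hasSubst_logSeries a), finsum_eq_single _ 0]
  · simp
  · intro k hk
    simp [logSeries, hk]

theorem mul_expCoeff (a : ℕ → K) (n : ℕ) :
    (n : K) * expCoeff a n = ∑ i ∈ range n, a (n - i) * expCoeff a i := by
  cases n with
  | zero => simp
  | succ n =>
    rw [Nat.cast_succ, mul_comm, expCoeff, ← PowerSeries.coeff_derivative,
      PowerSeries.derivative_subst (hasSubst_logSeries a), PowerSeries.derivative_exp,
      PowerSeries.coeff_mul, Finset.Nat.sum_antidiagonal_eq_sum_range_succ_mk]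
    refine sum_congr rfl fun i hi => ?_
    rw [coeff_derivative_logSeries, mul_comm, Nat.succ_sub (mem_range_succ_iff.1 hi)]
    rfl

theorem eq_expCoeff_of_mul_eq_sum {a c : ℕ → K} {n : ℕ} (h0 : c 0 = 1)
    (h : ∀ m ≤ n, (m : K) * c m = ∑ i ∈ range m, a (m - i) * c i) : c n = expCoeff a n := by
  induction n using Nat.strong_induction_on with
  | _ n ih =>
    rcases eq_or_ne n 0 with rfl | hn
    · rw [h0, expCoeff_zero]
    · apply mul_left_cancel₀ (Nat.cast_ne_zero.2 hn : (n : K) ≠ 0)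
      rw [h n le_rfl, mul_expCoeff]
      refine sum_congr rfl fun i hi => ?_
      have hin := mem_range.1 hi
      rw [ih i hin fun m hm => h m (hm.trans hin.le)]

theorem expCoeff_congr {a b : ℕ → K} {n : ℕ} (h : ∀ j ∈ Icc 1 n, a j = b j) :
    expCoeff a n = expCoeff b n := by
  refine eq_expCoeff_of_mul_eq_sum (expCoeff_zero a) fun m hm => ?_
  rw [mul_expCoeff]
  refine sum_congr rfl fun i hi => ?_
  have him := mem_range.1 hi
  rw [h (m - i) (mem_Icc.2 ⟨by omega, by omega⟩)]

theorem expCoeff_add (a b : ℕ → K) (n : ℕ) :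
    expCoeff (a + b) n = ∑ i ∈ range (n + 1), expCoeff a i * expCoeff b (n - i) := by
  set A := (PowerSeries.exp K).subst (logSeries a) with hA
  set B := (PowerSeries.exp K).subst (logSeries b) with hB
  have hlog : logSeries (a + b) = logSeries a + logSeries b := by
    ext j
    by_cases hj : j = 0 <;> simp [logSeries, hj, add_div]
  have hderiv : PowerSeries.derivative K (A * B) =
      PowerSeries.derivative K (logSeries (a + b)) * (A * B) := by
    rw [Derivation.leibniz, hA, hB, PowerSeries.derivative_subst (hasSubst_logSeries a),
      PowerSeries.derivative_subst (hasSubst_logSeries b), PowerSeries.derivative_exp, hlog,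
      map_add, smul_eq_mul, smul_eq_mul]
    ring
  have hzero : PowerSeries.coeff 0 (A * B) = 1 := by
    rw [PowerSeries.coeff_mul, Nat.antidiagonal_zero, sum_singleton]
    exact (congrArg₂ (· * ·) (expCoeff_zero a) (expCoeff_zero b)).trans (one_mul 1)
  rw [← eq_expCoeff_of_mul_eq_sum (c := fun n => PowerSeries.coeff n (A * B)) hzero,
    PowerSeries.coeff_mul, Finset.Nat.sum_antidiagonal_eq_sum_range_succ_mk]
  · rfl
  · rintro (_ | m) -
    · simp
    · rw [Nat.cast_succ, mul_comm, ← PowerSeries.coeff_derivative, hderiv, mul_comm,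
        PowerSeries.coeff_mul, Finset.Nat.sum_antidiagonal_eq_sum_range_succ_mk]
      refine sum_congr rfl fun i hi => ?_
      rw [coeff_derivative_logSeries, mul_comm, Nat.succ_sub (mem_range_succ_iff.1 hi)]

theorem map_expCoeff {L : Type*} [Field L] [CharZero L] (φ : K →+* L) (a : ℕ → K) (n : ℕ) :
    φ (expCoeff a n) = expCoeff (fun j => φ (a j)) n := by
  refine eq_expCoeff_of_mul_eq_sum (c := fun n => φ (expCoeff a n)) ?_ fun m _ => ?_
  · rw [expCoeff_zero, map_one]
  · rw [← map_natCast φ, ← map_mul, mul_expCoeff, map_sum]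
    exact sum_congr rfl fun i _ => map_mul φ _ _

end ExpCoeff

theorem mul_pCoeff (d : ℕ → ℝ) (n : ℕ) :
    (n : ℝ) * pCoeff d n = ∑ i ∈ range n, d (n - i) * pCoeff d i :=
  mul_expCoeff d n

theorem pCoeff_zero (d : ℕ → ℝ) : pCoeff d 0 = 1 := expCoeff_zero d

theorem expCoeff_ofReal (d : ℕ → ℝ) (n : ℕ) :
    expCoeff (fun j => (d j : ℂ)) n = (pCoeff d n : ℂ) :=
  (map_expCoeff Complex.ofRealHom d n).symm

section EntireExpansion

variable {a : ℕ → ℂ} {N : ℕ}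

theorem hasDerivAt_sum_div_mul_pow (a : ℕ → ℂ) (N : ℕ) (z : ℂ) :
    HasDerivAt (fun z => ∑ j ∈ Icc 1 N, a j / (j : ℂ) * z ^ j)
      (∑ j ∈ Icc 1 N, a j * z ^ (j - 1)) z := by
  refine (HasDerivAt.fun_sum fun j _ => (hasDerivAt_pow j z).const_mul (a j / (j : ℂ))).congr_deriv
    (sum_congr rfl fun j hj => ?_)
  have hj0 : (j : ℂ) ≠ 0 := Nat.cast_ne_zero.2 (Nat.one_le_iff_ne_zero.1 (mem_Icc.1 hj).1)
  rw [← mul_assoc, div_mul_cancel₀ _ hj0]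

theorem iteratedDeriv_sum_mul_pow_zero (ha : ∀ j, N < j → a j = 0) (i : ℕ) :
    iteratedDeriv i (fun z => ∑ j ∈ Icc 1 N, a j * z ^ (j - 1)) 0 = i.factorial * a (i + 1) := by
  have hterm (j : ℕ) : iteratedDeriv i (fun z : ℂ => a j * z ^ (j - 1)) 0 =
      if i = j - 1 then a j * i.factorial else 0 := by
    rw [iteratedDeriv_const_mul_field (a j) fun z : ℂ => z ^ (j - 1), iteratedDeriv_fun_pow_zero]
    split_ifs with h <;> simp [h]
  rw [iteratedDeriv_fun_sum fun j _ => by fun_prop, sum_congr rfl fun j _ => hterm j,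
    sum_eq_single (i + 1)]
  · simp [mul_comm]
  · intro j hj hji
    have := (mem_Icc.1 hj).1
    exact if_neg (by omega)
  · intro hi
    rw [ha (i + 1) (by simpa using hi), zero_mul, ite_self]

theorem inv_factorial_mul_iteratedDeriv_exp (ha : ∀ j, N < j → a j = 0) (n : ℕ) :
    (n.factorial : ℂ)⁻¹ *
        iteratedDeriv n (fun z => Complex.exp (∑ j ∈ Icc 1 N, a j / (j : ℂ) * z ^ j)) 0 =
      expCoeff a n := by
  set F : ℂ → ℂ := fun z => Complex.exp (∑ j ∈ Icc 1 N, a j / (j : ℂ) * z ^ j) with hF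
  set D : ℂ → ℂ := fun z => ∑ j ∈ Icc 1 N, a j * z ^ (j - 1) with hD
  have hderiv : deriv F = F * D := funext fun z => (hasDerivAt_sum_div_mul_pow a N z).cexp.deriv
  have hFc (k : ℕ) : ContDiff ℂ k F := by fun_prop
  have hDc (k : ℕ) : ContDiff ℂ k D := by fun_prop
  refine eq_expCoeff_of_mul_eq_sum
    (c := fun n => (n.factorial : ℂ)⁻¹ * iteratedDeriv n F 0) ?_ fun m _ => ?_
  · have hzero : ∑ j ∈ Icc 1 N, a j / (j : ℂ) * 0 ^ j = 0 := sum_eq_zero fun j hj => by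
      rw [zero_pow (Nat.one_le_iff_ne_zero.1 (mem_Icc.1 hj).1), mul_zero]
    simp [hF, hzero]
  · cases m with
    | zero => simp
    | succ m =>
      rw [iteratedDeriv_succ', hderiv, iteratedDeriv_mul (hFc m).contDiffAt
        (hDc m).contDiffAt, mul_sum, mul_sum]
      refine sum_congr rfl fun i hi => ?_
      have him := mem_range_succ_iff.1 hi
      rw [hD, iteratedDeriv_sum_mul_pow_zero ha, Nat.cast_choose ℂ him, Nat.succ_sub him,
        Nat.factorial_succ]
      have := Nat.factorial_ne_zero m
      have := Nat.factorial_ne_zero (m - i)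
      push_cast
      field_simp

theorem hasSum_expCoeff (ha : ∀ j, N < j → a j = 0) (z : ℂ) :
    HasSum (fun n => expCoeff a n * z ^ n)
      (Complex.exp (∑ j ∈ Icc 1 N, a j / (j : ℂ) * z ^ j)) := by
  have hF : Differentiable ℂ fun z => Complex.exp (∑ j ∈ Icc 1 N, a j / (j : ℂ) * z ^ j) := by
    fun_prop
  refine (Complex.hasSum_taylorSeries_of_entire hF 0 z).congr_fun fun n => ?_
  rw [← inv_factorial_mul_iteratedDeriv_exp ha, sub_zero, smul_eq_mul, smul_eq_mul]
  ring

end EntireExpansion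

section AbelSum

theorem one_sub_mul_sum_partialSum_mul_pow {R : Type*} [CommRing R] (x : ℕ → R) (r : R) (m : ℕ) :
    (1 - r) * ∑ i ∈ range m, (∑ k ∈ range i, x k) * r ^ i =
      r * ∑ i ∈ range m, x i * r ^ i - r ^ m * ∑ k ∈ range m, x k := by
  induction m with
  | zero => simp
  | succ m ih =>
    simp only [sum_range_succ, mul_add, ih]
    ring

theorem sum_mul_pow_le_of_partialSum_le {x y : ℕ → ℝ} {r : ℝ} (hr0 : 0 < r) (hr1 : r ≤ 1)
    (h : ∀ n, ∑ k ∈ range n, x k ≤ ∑ k ∈ range n, y k) (m : ℕ) :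
    ∑ i ∈ range m, x i * r ^ i ≤ ∑ i ∈ range m, y i * r ^ i := by
  have hsum : (1 - r) * ∑ i ∈ range m, (∑ k ∈ range i, x k) * r ^ i ≤
      (1 - r) * ∑ i ∈ range m, (∑ k ∈ range i, y k) * r ^ i :=
    mul_le_mul_of_nonneg_left
      (sum_le_sum fun i _ => mul_le_mul_of_nonneg_right (h i) (pow_nonneg hr0.le i))
      (sub_nonneg.2 hr1)
  have hlast := mul_le_mul_of_nonneg_left (h m) (pow_nonneg hr0.le m)
  rw [one_sub_mul_sum_partialSum_mul_pow, one_sub_mul_sum_partialSum_mul_pow] at hsum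
  exact le_of_mul_le_mul_left (by linarith) hr0

end AbelSum

section AbelRadius

/-- The radius `exp (-K / (n + 1))` at which Abel means of order `n` are taken. -/
noncomputable def abelRadius (K : ℝ) (n : ℕ) : ℝ := Real.exp (-(K / (n + 1)))

variable {K : ℝ}

theorem abelRadius_pos (K : ℝ) (n : ℕ) : 0 < abelRadius K n := Real.exp_pos _

theorem abelRadius_lt_one (hK : 0 < K) (n : ℕ) : abelRadius K n < 1 := by
  rw [abelRadius, Real.exp_lt_one_iff, neg_lt_zero]
  positivity

theorem abelRadius_pow (K : ℝ) (n j : ℕ) :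
    abelRadius K n ^ j = Real.exp (-(K * (j / (n + 1)))) := by
  rw [abelRadius, ← Real.exp_nat_mul]
  congr 1
  ring

theorem one_sub_abelRadius_pow_le (K : ℝ) (n j : ℕ) :
    1 - abelRadius K n ^ j ≤ K * (j / (n + 1)) := by
  rw [abelRadius_pow]
  linarith [Real.one_sub_le_exp_neg (K * (j / (n + 1)))]

theorem exp_neg_le_abelRadius_pow (hK : 0 ≤ K) {n j : ℕ} (hj : j ≤ n) :
    Real.exp (-K) ≤ abelRadius K n ^ j := by
  rw [abelRadius_pow, Real.exp_le_exp, neg_le_neg_iff]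
  refine mul_le_of_le_one_right hK ((div_le_one (by positivity)).2 ?_)
  exact_mod_cast hj.trans n.le_succ

theorem abelRadius_div_one_sub_le (hK : 0 < K) (n : ℕ) :
    abelRadius K n / (1 - abelRadius K n) ≤ (n + 1) / K := by
  have hn : (0 : ℝ) < n + 1 := by positivity
  rw [div_le_div_iff₀ (sub_pos.2 (abelRadius_lt_one hK n)) hK]
  have h := mul_le_mul_of_nonneg_right (Real.add_one_le_exp (K / (n + 1))) (abelRadius_pos K n).le
  rw [abelRadius, ← Real.exp_add, add_neg_cancel, Real.exp_zero, ← abelRadius,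
    div_add_one hn.ne', div_mul_eq_mul_div, div_le_one hn] at h
  linarith

end AbelRadius

section PCoeffBounds

variable {a b : ℝ} {d : ℕ → ℝ}

theorem pCoeff_pos (hd : ∀ j, 1 ≤ j → 0 < d j) (n : ℕ) : 0 < pCoeff d n := by
  induction n using Nat.strong_induction_on with
  | _ n ih =>
    rcases n.eq_zero_or_pos with rfl | hn
    · rw [pCoeff_zero]
      exact one_pos
    · refine pos_of_mul_pos_right (a := (n : ℝ)) ?_ n.cast_nonneg
      rw [mul_pCoeff]
      refine sum_pos (fun i hi => ?_) ⟨0, mem_range.2 hn⟩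
      have hin := mem_range.1 hi
      exact mul_pos (hd _ (by omega)) (ih i hin)

theorem mul_sum_pCoeff_le (ha : 0 < a) (hlo : ∀ j, 1 ≤ j → a ≤ d j) (n : ℕ) :
    a * ∑ i ∈ range n, pCoeff d i ≤ n * pCoeff d n := by
  rw [mul_pCoeff, mul_sum]
  refine sum_le_sum fun i hi => ?_
  have hin := mem_range.1 hi
  exact mul_le_mul_of_nonneg_right (hlo _ (by omega))
    (pCoeff_pos (fun j hj => ha.trans_le (hlo j hj)) i).le

theorem mul_pCoeff_le_sum (hd : ∀ j, 1 ≤ j → 0 < d j) (hhi : ∀ j, 1 ≤ j → d j ≤ b) (n : ℕ) :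
    n * pCoeff d n ≤ b * ∑ i ∈ range n, pCoeff d i := by
  rw [mul_pCoeff, mul_sum]
  refine sum_le_sum fun i hi => ?_
  have hin := mem_range.1 hi
  exact mul_le_mul_of_nonneg_right (hhi _ (by omega)) (pCoeff_pos hd i).le

theorem mul_sum_range_succ_pCoeff_le (ha : 0 < a) (ha1 : a ≤ 1) (hlo : ∀ j, 1 ≤ j → a ≤ d j)
    (n : ℕ) : a * ∑ i ∈ range (n + 1), pCoeff d i ≤ (n + 1) * pCoeff d n := by
  have hp := pCoeff_pos (fun j hj => ha.trans_le (hlo j hj)) n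
  rw [sum_range_succ, mul_add, add_one_mul]
  exact add_le_add (mul_sum_pCoeff_le ha hlo n) (mul_le_of_le_one_left hp.le ha1)

theorem succ_mul_pCoeff_le_sum (hd : ∀ j, 1 ≤ j → 0 < d j) (hhi : ∀ j, 1 ≤ j → d j ≤ b) (n : ℕ) :
    (n + 1) * pCoeff d n ≤ (b + 1) * ∑ i ∈ range (n + 1), pCoeff d i := by
  have hb : 0 < b := (hd 1 le_rfl).trans_le (hhi 1 le_rfl)
  have hp := pCoeff_pos hd n
  have hsum : 0 ≤ ∑ i ∈ range n, pCoeff d i := sum_nonneg fun i _ => (pCoeff_pos hd i).le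
  have h := mul_pCoeff_le_sum hd hhi n
  rw [sum_range_succ]
  nlinarith

theorem monotone_sum_pCoeff_div_rpow (ha : 0 < a) (ha1 : a ≤ 1) (hlo : ∀ j, 1 ≤ j → a ≤ d j) :
    Monotone fun n : ℕ => (∑ i ∈ range (n + 1), pCoeff d i) / ((n : ℝ) + 1) ^ a := by
  refine monotone_nat_of_le_succ fun n => ?_
  have hn : (0 : ℝ) < n + 1 := by positivity
  set S := ∑ i ∈ range (n + 1), pCoeff d i
  have hS : 0 ≤ S := sum_nonneg fun i _ => (pCoeff_pos (fun j hj => ha.trans_le (hlo j hj)) i).le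
  have hstep : a * S ≤ (n + 1) * pCoeff d (n + 1) := by
    simpa only [Nat.cast_succ] using mul_sum_pCoeff_le ha hlo (n + 1)
  have hbernoulli : (1 + 1 / ((n : ℝ) + 1)) ^ a ≤ 1 + a * (1 / (n + 1)) :=
    rpow_one_add_le_one_add_mul_self (by linarith [one_div_pos.2 hn]) ha.le ha1
  have hsplit : (n : ℝ) + 1 + 1 = (1 + 1 / (n + 1)) * (n + 1) := by field_simp
  rw [sum_range_succ, Nat.cast_succ, hsplit, Real.mul_rpow (by positivity) hn.le,
    ← div_div, div_le_div_iff_of_pos_right (by positivity), le_div_iff₀ (by positivity)]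
  calc S * (1 + 1 / ((n : ℝ) + 1)) ^ a ≤ S * (1 + a * (1 / (n + 1))) := by gcongr
    _ = S + a * S / (n + 1) := by ring
    _ ≤ S + pCoeff d (n + 1) := by
        gcongr
        rwa [div_le_iff₀' hn]

theorem pCoeff_le_mul_rpow (ha : 0 < a) (ha1 : a ≤ 1) (hlo : ∀ j, 1 ≤ j → a ≤ d j)
    (hhi : ∀ j, 1 ≤ j → d j ≤ b) {i n : ℕ} (hin : i ≤ n) :
    pCoeff d i ≤ (b + 1) / a * pCoeff d n * (((n : ℝ) + 1) / (i + 1)) ^ (1 - a) := by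
  have hd : ∀ j, 1 ≤ j → 0 < d j := fun j hj => ha.trans_le (hlo j hj)
  have hb : 0 < b := (hd 1 le_rfl).trans_le (hhi 1 le_rfl)
  have hi : (0 : ℝ) < i + 1 := by positivity
  have hn : (0 : ℝ) < n + 1 := by positivity
  calc pCoeff d i ≤ (b + 1) * (∑ k ∈ range (i + 1), pCoeff d k) / (i + 1) := by
        rw [le_div_iff₀' hi]
        exact succ_mul_pCoeff_le_sum hd hhi i
    _ = (b + 1) / (i + 1) * (i + 1) ^ a *
          ((∑ k ∈ range (i + 1), pCoeff d k) / ((i : ℝ) + 1) ^ a) := by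
        field_simp
    _ ≤ (b + 1) / (i + 1) * (i + 1) ^ a *
          ((∑ k ∈ range (n + 1), pCoeff d k) / ((n : ℝ) + 1) ^ a) := by
        exact mul_le_mul_of_nonneg_left (monotone_sum_pCoeff_div_rpow ha ha1 hlo hin)
          (by positivity)
    _ ≤ (b + 1) / (i + 1) * (i + 1) ^ a * ((n + 1) * pCoeff d n / a / ((n : ℝ) + 1) ^ a) := by
        gcongr
        rw [le_div_iff₀' ha]
        exact mul_sum_range_succ_pCoeff_le ha ha1 hlo n
    _ = _ := by
        rw [Real.rpow_sub (by positivity), Real.rpow_one, Real.div_rpow hn.le hi.le]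
        field_simp

end PCoeffBounds

section AbelMeans

variable {a b r : ℝ} {d : ℕ → ℝ}

theorem sum_mul_pCoeff_mul_pow_le (hd : ∀ j, 1 ≤ j → 0 < d j) (hhi : ∀ j, 1 ≤ j → d j ≤ b)
    (hr0 : 0 ≤ r) (hr1 : r < 1) (m : ℕ) :
    ∑ i ∈ range m, (i : ℝ) * (pCoeff d i * r ^ i) ≤
      b * (r / (1 - r)) * ∑ i ∈ range m, pCoeff d i * r ^ i := by
  have hb : 0 < b := (hd 1 le_rfl).trans_le (hhi 1 le_rfl)
  have hr : 0 < 1 - r := sub_pos.2 hr1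
  have hp := fun i => (pCoeff_pos hd i).le
  calc ∑ i ∈ range m, (i : ℝ) * (pCoeff d i * r ^ i)
      ≤ ∑ i ∈ range m, b * ((∑ k ∈ range i, pCoeff d k) * r ^ i) := by
        refine sum_le_sum fun i _ => ?_
        rw [← mul_assoc, ← mul_assoc]
        exact mul_le_mul_of_nonneg_right (mul_pCoeff_le_sum hd hhi i) (pow_nonneg hr0 i)
    _ = b / (1 - r) * (r * ∑ i ∈ range m, pCoeff d i * r ^ i -
          r ^ m * ∑ k ∈ range m, pCoeff d k) := by
        rw [← one_sub_mul_sum_partialSum_mul_pow, ← mul_sum, ← mul_assoc, div_mul_cancel₀ _ hr.ne']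
    _ ≤ b / (1 - r) * (r * ∑ i ∈ range m, pCoeff d i * r ^ i) := by
        gcongr
        exact sub_le_self _ (mul_nonneg (pow_nonneg hr0 m) (sum_nonneg fun i _ => hp i))
    _ = _ := by ring

theorem sum_mul_pCoeff_mul_abelRadius_pow_le (hd : ∀ j, 1 ≤ j → 0 < d j)
    (hhi : ∀ j, 1 ≤ j → d j ≤ b) (n m : ℕ) :
    ∑ i ∈ range m, (i : ℝ) * (pCoeff d i * abelRadius (10 * b) n ^ i) ≤
      (n + 1) / 10 * ∑ i ∈ range m, pCoeff d i * abelRadius (10 * b) n ^ i := by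
  have hb : 0 < b := (hd 1 le_rfl).trans_le (hhi 1 le_rfl)
  have hK : 0 < 10 * b := by positivity
  have hr := abelRadius_pos (10 * b) n
  refine (sum_mul_pCoeff_mul_pow_le hd hhi hr.le (abelRadius_lt_one hK n) m).trans
    (mul_le_mul_of_nonneg_right ?_ (sum_nonneg fun i _ => mul_nonneg (pCoeff_pos hd i).le
      (pow_nonneg hr.le i)))
  calc b * (abelRadius (10 * b) n / (1 - abelRadius (10 * b) n))
      ≤ b * ((n + 1) / (10 * b)) :=
        mul_le_mul_of_nonneg_left (abelRadius_div_one_sub_le hK n) hb.le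
    _ = (n + 1) / 10 := by field_simp

/-- The part `∑_{i < n} p_i r ^ i` of the Abel sum of `p` at `r = abelRadius K n` below `n`. -/
noncomputable def abelHead (d : ℕ → ℝ) (K : ℝ) (n : ℕ) : ℝ :=
  ∑ i ∈ range n, pCoeff d i * abelRadius K n ^ i

theorem mul_abelHead_le (ha : 0 < a) (hlo : ∀ j, 1 ≤ j → a ≤ d j) {K : ℝ} (hK : 0 < K) (n : ℕ) :
    a * abelHead d K n ≤ n * pCoeff d n := by
  refine le_trans (mul_le_mul_of_nonneg_left (sum_le_sum fun i _ => ?_) ha.le)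
    (mul_sum_pCoeff_le ha hlo n)
  exact mul_le_of_le_one_right (pCoeff_pos (fun j hj => ha.trans_le (hlo j hj)) i).le
    (pow_le_one₀ (abelRadius_pos K n).le (abelRadius_lt_one hK n).le)

theorem exp_neg_mul_le_mul_abelHead (hd : ∀ j, 1 ≤ j → 0 < d j) (hhi : ∀ j, 1 ≤ j → d j ≤ b)
    {K : ℝ} (hK : 0 ≤ K) (n : ℕ) :
    Real.exp (-K) * (n * pCoeff d n) ≤ b * abelHead d K n := by
  have hb : 0 < b := (hd 1 le_rfl).trans_le (hhi 1 le_rfl)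
  calc Real.exp (-K) * (n * pCoeff d n) ≤ Real.exp (-K) * (b * ∑ i ∈ range n, pCoeff d i) :=
        mul_le_mul_of_nonneg_left (mul_pCoeff_le_sum hd hhi n) (Real.exp_pos _).le
    _ = b * ∑ i ∈ range n, pCoeff d i * Real.exp (-K) := by rw [← sum_mul]; ring
    _ ≤ b * abelHead d K n := by
        refine mul_le_mul_of_nonneg_left (sum_le_sum fun i hi => ?_) hb.le
        exact mul_le_mul_of_nonneg_left (exp_neg_le_abelRadius_pow hK (mem_range.1 hi).le)
          (pCoeff_pos hd i).le

theorem sum_Ico_pCoeff_mul_abelRadius_pow_le (hd : ∀ j, 1 ≤ j → 0 < d j)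
    (hhi : ∀ j, 1 ≤ j → d j ≤ b) {n : ℕ} (hn : 1 ≤ n) (m : ℕ) :
    ∑ i ∈ Ico n m, ((i : ℝ) + 1) / (n + 1) * (pCoeff d i * abelRadius (10 * b) n ^ i) ≤
      abelHead d (10 * b) n / 4 := by
  set r := abelRadius (10 * b) n
  set H := abelHead d (10 * b) n
  have hn0 : (0 : ℝ) < n + 1 := by positivity
  have hp (i : ℕ) : 0 ≤ pCoeff d i * r ^ i :=
    mul_nonneg (pCoeff_pos hd i).le (pow_nonneg (abelRadius_pos _ n).le i)
  rcases le_total m n with hmn | hnm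
  · rw [Ico_eq_empty_of_le hmn, sum_empty]
    exact div_nonneg (sum_nonneg fun i _ => hp i) (by norm_num)
  set T := ∑ i ∈ Ico n m, ((i : ℝ) + 1) / (n + 1) * (pCoeff d i * r ^ i)
  have hmass : ∑ i ∈ range m, pCoeff d i * r ^ i ≤ H + T := by
    rw [← sum_range_add_sum_Ico _ hnm]
    refine add_le_add_right (sum_le_sum fun i hi => le_mul_of_one_le_left (hp i) ?_) _
    rw [one_le_div hn0]
    exact_mod_cast Nat.succ_le_succ (mem_Ico.1 hi).1
  have hmoment : T ≤ 2 / (n + 1) * ∑ i ∈ range m, (i : ℝ) * (pCoeff d i * r ^ i) := by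
    rw [← sum_range_add_sum_Ico _ hnm, mul_add, mul_sum (Ico n m)]
    refine le_add_of_nonneg_of_le
      (mul_nonneg (by positivity) (sum_nonneg fun i _ => mul_nonneg i.cast_nonneg (hp i)))
      (sum_le_sum fun i hi => ?_)
    have hi1 : (1 : ℝ) ≤ i := by exact_mod_cast hn.trans (mem_Ico.1 hi).1
    have hweight : ((i : ℝ) + 1) / (n + 1) ≤ 2 / (n + 1) * i := by
      rw [div_mul_eq_mul_div]
      exact div_le_div_of_nonneg_right (by linarith) hn0.le
    exact (mul_le_mul_of_nonneg_right hweight (hp i)).trans_eq (mul_assoc _ _ _)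
  have hmarkov : T ≤ (∑ i ∈ range m, pCoeff d i * r ^ i) / 5 := by
    calc T ≤ 2 / (n + 1) * ((n + 1) / 10 * ∑ i ∈ range m, pCoeff d i * r ^ i) :=
          hmoment.trans (mul_le_mul_of_nonneg_left
            (sum_mul_pCoeff_mul_abelRadius_pow_le hd hhi n m) (by positivity))
      _ = _ := by
          field_simp
          ring
  linarith

theorem sum_range_pCoeff_mul_abelRadius_pow_le (hd : ∀ j, 1 ≤ j → 0 < d j)
    (hhi : ∀ j, 1 ≤ j → d j ≤ b) {n : ℕ} (hn : 1 ≤ n) (m : ℕ) :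
    ∑ l ∈ range m, (((n + l : ℕ) : ℝ) + 1) / (n + 1) *
        (pCoeff d (n + l) * abelRadius (10 * b) n ^ (n + l)) ≤ abelHead d (10 * b) n / 4 := by
  have h := sum_Ico_pCoeff_mul_abelRadius_pow_le hd hhi hn (n + m)
  rwa [sum_Ico_eq_sum_range, Nat.add_sub_cancel_left] at h

theorem summable_pCoeff_mul_abelRadius_pow (hd : ∀ j, 1 ≤ j → 0 < d j)
    (hhi : ∀ j, 1 ≤ j → d j ≤ b) {n : ℕ} (hn : 1 ≤ n) :
    Summable fun l : ℕ => (((n + l : ℕ) : ℝ) + 1) / (n + 1) *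
      (pCoeff d (n + l) * abelRadius (10 * b) n ^ (n + l)) :=
  summable_of_sum_range_le (fun l => mul_nonneg (by positivity) (mul_nonneg (pCoeff_pos hd _).le
    (pow_nonneg (abelRadius_pos _ n).le _))) (sum_range_pCoeff_mul_abelRadius_pow_le hd hhi hn)

end AbelMeans

section RangeSums

theorem sum_Icc_one_eq_sum_range {M : Type*} [AddCommMonoid M] (f : ℕ → M) (n : ℕ) :
    ∑ j ∈ Icc 1 n, f j = ∑ k ∈ range n, f (k + 1) := by
  rw [range_eq_Ico, sum_Ico_add']
  rfl

theorem sum_Icc_one_add_sum_Ioc {M : Type*} [AddCommMonoid M] (f : ℕ → M) {m n : ℕ} (h : m ≤ n) :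
    ∑ j ∈ Icc 1 m, f j + ∑ j ∈ Ioc m n, f j = ∑ j ∈ Icc 1 n, f j :=
  sum_Ioc_consecutive f m.zero_le h

theorem sum_range_sub_eq_sum_Icc_one {M : Type*} [AddCommMonoid M] (f : ℕ → M) (n : ℕ) :
    ∑ i ∈ range n, f (n - i) = ∑ j ∈ Icc 1 n, f j := by
  rw [sum_Icc_one_eq_sum_range, ← sum_range_reflect]
  refine sum_congr rfl fun i hi => congrArg f ?_
  have := mem_range.1 hi
  omega

theorem sum_div_rpow_le {c : ℝ} (hc0 : 0 ≤ c) (hc1 : c < 1) (n : ℕ) :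
    ∑ i ∈ range n, (((n : ℝ) + 1) / (i + 1)) ^ c ≤ n / (1 - c) := by
  have hc : 0 < 1 - c := sub_pos.2 hc1
  induction n with
  | zero => simp
  | succ n ih =>
    have hn : (0 : ℝ) < n + 1 := by positivity
    have hsplit (i : ℕ) : ((n + 1 : ℕ) + 1 : ℝ) / (i + 1) =
        (1 + 1 / (n + 1)) * (((n : ℝ) + 1) / (i + 1)) := by
      push_cast
      field_simp
    have hterm (i : ℕ) : (((n + 1 : ℕ) + 1 : ℝ) / (i + 1)) ^ c =
        (1 + 1 / (n + 1)) ^ c * (((n : ℝ) + 1) / (i + 1)) ^ c := by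
      rw [hsplit, Real.mul_rpow (by positivity) (by positivity)]
    have hbernoulli : (1 + 1 / ((n : ℝ) + 1)) ^ c ≤ 1 + c * (1 / (n + 1)) :=
      rpow_one_add_le_one_add_mul_self (by linarith [one_div_pos.2 hn]) hc0 hc1.le
    rw [sum_congr rfl fun i _ => hterm i, ← mul_sum, sum_range_succ, div_self hn.ne', Real.one_rpow]
    calc _ ≤ (1 + c * (1 / ((n : ℝ) + 1))) * (n / (1 - c) + 1) := by gcongr
      _ = (n + 1 - c ^ 2 / (n + 1)) / (1 - c) := by
        field_simp
        ring
      _ ≤ ((n + 1 : ℕ) : ℝ) / (1 - c) := by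
        push_cast
        gcongr
        exact sub_le_self _ (by positivity)

end RangeSums

section CesaroBounded

variable {E F : Type*} [NormedAddCommGroup E] [NormedAddCommGroup F] {s ε : ℝ} {e : ℕ → E}

/-- The `s`-th power means `(n⁻¹ ∑_{j=1}^n ‖e_j‖ ^ s) ^ (1 / s)` are all at most `ε`. Both
`sup_j ‖e_j‖ ≤ ε` and `∑_j ‖e_j‖ ^ s / j ≤ ε ^ s` imply this, so it treats `p = ∞` and `p < ∞`
alike. -/
def IsCesaroBounded (s ε : ℝ) (e : ℕ → E) : Prop :=
  ∀ n : ℕ, ∑ j ∈ Icc 1 n, ‖e j‖ ^ s ≤ n * ε ^ s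

theorem IsCesaroBounded.of_norm_le_mul (he : IsCesaroBounded s ε e) (hs : 0 ≤ s) (hε : 0 ≤ ε)
    {c : ℝ} (hc : 0 ≤ c) {x : ℕ → F} (hx : ∀ j, 1 ≤ j → ‖x j‖ ≤ c * ‖e j‖) :
    IsCesaroBounded s (c * ε) x := fun n => by
  calc ∑ j ∈ Icc 1 n, ‖x j‖ ^ s ≤ ∑ j ∈ Icc 1 n, (c * ‖e j‖) ^ s :=
        sum_le_sum fun j hj => Real.rpow_le_rpow (norm_nonneg _) (hx j (mem_Icc.1 hj).1) hs
    _ = c ^ s * ∑ j ∈ Icc 1 n, ‖e j‖ ^ s := by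
        rw [mul_sum]
        exact sum_congr rfl fun j _ => Real.mul_rpow hc (norm_nonneg _)
    _ ≤ c ^ s * (n * ε ^ s) := by gcongr; exact he n
    _ = n * (c * ε) ^ s := by rw [Real.mul_rpow hc hε]; ring

theorem IsCesaroBounded.sum_norm_le (he : IsCesaroBounded s ε e) (hs : 1 ≤ s) (hε : 0 ≤ ε)
    (n : ℕ) : ∑ j ∈ Icc 1 n, ‖e j‖ ≤ n * ε := by
  rcases n.eq_zero_or_pos with rfl | hn
  · simp
  have hn0 : (0 : ℝ) < n := Nat.cast_pos.2 hn
  have hs0 : 0 < s := one_pos.trans_le hs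
  refine (Real.rpow_le_rpow_iff (sum_nonneg fun j _ => norm_nonneg _) (by positivity) hs0).1 ?_
  calc (∑ j ∈ Icc 1 n, ‖e j‖) ^ s ≤ (n : ℝ) ^ (s - 1) * ∑ j ∈ Icc 1 n, ‖e j‖ ^ s := by
        simpa using Real.rpow_sum_le_const_mul_sum_rpow_of_nonneg (Icc 1 n) hs
          fun j _ => norm_nonneg (e j)
    _ ≤ (n : ℝ) ^ (s - 1) * (n * ε ^ s) := by gcongr; exact he n
    _ = (n * ε) ^ s := by
        rw [Real.mul_rpow hn0.le hε, Real.rpow_sub_one hn0.ne']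
        field_simp

end CesaroBounded

section LogGrowth

variable {E : Type*} [NormedAddCommGroup E] {ε : ℝ} {e : ℕ → E}

theorem sum_Ioc_norm_div_le_add_log (he : ∀ n : ℕ, ∑ j ∈ Icc 1 n, ‖e j‖ ≤ n * ε) (hε : 0 ≤ ε)
    {i n : ℕ} (hin : i ≤ n) :
    ∑ j ∈ Ioc i n, ‖e j‖ / j ≤
      (∑ j ∈ Icc 1 n, ‖e j‖) / (n + 1) + ε * Real.log (((n : ℝ) + 1) / (i + 1)) := by
  induction n, hin using Nat.le_induction with
  | base =>
    rw [Ioc_self, sum_empty, div_self (by positivity), Real.log_one, mul_zero, add_zero]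
    exact div_nonneg (sum_nonneg fun j _ => norm_nonneg _) (by positivity)
  | succ n hin ih =>
    have hn : (0 : ℝ) < n + 1 := by positivity
    have hsum := he (n + 1)
    rw [sum_Icc_succ_top (by omega)] at hsum ⊢
    rw [sum_Ioc_succ_top hin]
    push_cast at hsum ⊢
    set G := ∑ j ∈ Icc 1 n, ‖e j‖
    have hlog : Real.log (((n : ℝ) + 1 + 1) / (i + 1)) =
        Real.log (((n : ℝ) + 1 + 1) / (n + 1)) + Real.log (((n : ℝ) + 1) / (i + 1)) := by
      rw [← Real.log_mul (by positivity) (by positivity), div_mul_div_cancel₀ hn.ne']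
    have hinv : 1 / ((n : ℝ) + 1 + 1) ≤ Real.log (((n : ℝ) + 1 + 1) / (n + 1)) := by
      refine le_trans (le_of_eq ?_) (Real.one_sub_inv_le_log_of_pos (by positivity))
      field_simp
      ring
    have hstep : (G + ‖e (n + 1)‖) / (n + 1) ≤
        (G + ‖e (n + 1)‖) / (n + 1 + 1) + ε * (1 / (n + 1 + 1)) := by
      rw [← sub_nonneg]
      have : 0 ≤ ((n + 1) * ε - (G + ‖e (n + 1)‖)) / ((n + 1) * (n + 1 + 1)) :=
        div_nonneg (sub_nonneg.2 hsum) (by positivity)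
      refine this.trans_eq ?_
      field_simp
      ring
    rw [hlog, mul_add]
    rw [add_div] at hstep
    linarith [mul_le_mul_of_nonneg_left hinv hε]

theorem sum_Ioc_norm_div_le (he : ∀ n : ℕ, ∑ j ∈ Icc 1 n, ‖e j‖ ≤ n * ε) (hε : 0 ≤ ε)
    {i n : ℕ} (hin : i ≤ n) :
    ∑ j ∈ Ioc i n, ‖e j‖ / j ≤ ε * (1 + Real.log (((n : ℝ) + 1) / (i + 1))) := by
  have hmean : (∑ j ∈ Icc 1 n, ‖e j‖) / (n + 1) ≤ ε := by
    rw [div_le_iff₀' (by positivity)]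
    exact (he n).trans (by gcongr; linarith)
  linarith [sum_Ioc_norm_div_le_add_log he hε hin]

theorem exp_mul_one_add_log_le {γ u : ℝ} (hε : 0 ≤ ε) (hεγ : ε ≤ γ) (hγ0 : 0 < γ) (hγ1 : γ ≤ 1)
    (hu : 0 < u) : Real.exp (ε * (1 + Real.log u)) ≤ 1 + 3 * (ε / γ) * u ^ γ := by
  have hexp : Real.exp (γ * (1 + Real.log u)) ≤ 3 * u ^ γ := by
    rw [mul_add, Real.exp_add, mul_one, mul_comm γ, ← Real.rpow_def_of_pos hu]
    have : Real.exp γ ≤ 3 := (Real.exp_le_exp.2 hγ1).trans Real.exp_one_lt_three.le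
    gcongr
  have hconv := convexOn_exp.2 (Set.mem_univ (γ * (1 + Real.log u))) (Set.mem_univ 0)
    (div_nonneg hε hγ0.le) (sub_nonneg.2 ((div_le_one hγ0).2 hεγ)) (add_sub_cancel _ _)
  simp only [smul_eq_mul, mul_zero, add_zero, Real.exp_zero, mul_one] at hconv
  rw [← mul_assoc, div_mul_cancel₀ _ hγ0.ne'] at hconv
  linarith [mul_le_mul_of_nonneg_left hexp (div_nonneg hε hγ0.le), div_nonneg hε hγ0.le]

end LogGrowth

section AbelPerturbation

variable {𝕜 : Type*} [RCLike 𝕜] {ε K r : ℝ} {e : ℕ → 𝕜}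

theorem sum_norm_mul_pow_le (he : ∀ n : ℕ, ∑ j ∈ Icc 1 n, ‖e j‖ ≤ n * ε) (hε : 0 ≤ ε)
    (hr0 : 0 < r) (hr1 : r < 1) (N : ℕ) :
    ∑ j ∈ Icc 1 N, ‖e j‖ * r ^ j ≤ ε * (r / (1 - r)) := by
  have hpartial (n : ℕ) : ∑ k ∈ range n, ‖e (k + 1)‖ ≤ ∑ _k ∈ range n, ε := by
    rw [sum_const, card_range, nsmul_eq_mul, ← sum_Icc_one_eq_sum_range (fun j => ‖e j‖)]
    exact he n
  have hgeom : ∑ k ∈ range N, r ^ k ≤ 1 / (1 - r) := by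
    rw [le_div_iff₀ (sub_pos.2 hr1), geom_sum_mul_neg]
    exact sub_le_self _ (by positivity)
  calc ∑ j ∈ Icc 1 N, ‖e j‖ * r ^ j = r * ∑ k ∈ range N, ‖e (k + 1)‖ * r ^ k := by
        rw [sum_Icc_one_eq_sum_range, mul_sum]
        exact sum_congr rfl fun k _ => by ring
    _ ≤ r * ∑ k ∈ range N, ε * r ^ k := by
        gcongr r * ?_
        exact sum_mul_pow_le_of_partialSum_le hr0 hr1.le hpartial N
    _ = r * ε * ∑ k ∈ range N, r ^ k := by rw [← mul_sum, mul_assoc]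
    _ ≤ r * ε * (1 / (1 - r)) := by gcongr
    _ = _ := by ring

theorem norm_sum_div_mul_abelRadius_pow_sub_one_le
    (he : ∀ n : ℕ, ∑ j ∈ Icc 1 n, ‖e j‖ ≤ n * ε) (hε : 0 ≤ ε) (hK : 0 < K) (n : ℕ) :
    ‖∑ j ∈ Icc 1 n, e j / j * ((abelRadius K n : 𝕜) ^ j - 1)‖ ≤ K * ε := by
  set r := abelRadius K n
  calc _ ≤ ∑ j ∈ Icc 1 n, K / (n + 1) * ‖e j‖ := by
        refine norm_sum_le_of_le _ fun j hj => ?_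
        have hj : (0 : ℝ) < j := Nat.cast_pos.2 (mem_Icc.1 hj).1
        have hpow : ‖(r : 𝕜) ^ j - 1‖ ≤ K * (j / (n + 1)) := by
          rw [norm_sub_rev, ← RCLike.ofReal_pow, ← RCLike.ofReal_one, ← RCLike.ofReal_sub,
            RCLike.norm_of_nonneg (sub_nonneg.2
              (pow_le_one₀ (abelRadius_pos K n).le (abelRadius_lt_one hK n).le))]
          exact one_sub_abelRadius_pow_le K n j
        rw [norm_mul, norm_div, RCLike.norm_natCast]
        calc ‖e j‖ / j * ‖(r : 𝕜) ^ j - 1‖ ≤ ‖e j‖ / j * (K * (j / (n + 1))) := by gcongr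
          _ = _ := by field_simp
    _ ≤ K / (n + 1) * ((n + 1) * ε) := by
        rw [← mul_sum]
        gcongr
        exact (he n).trans (by gcongr; linarith)
    _ = K * ε := by field_simp

theorem norm_sum_Ioc_div_mul_abelRadius_pow_le
    (he : ∀ n : ℕ, ∑ j ∈ Icc 1 n, ‖e j‖ ≤ n * ε) (hε : 0 ≤ ε) (hK : 0 < K) {n N : ℕ}
    (hnN : n ≤ N) : ‖∑ j ∈ Ioc n N, e j / j * (abelRadius K n : 𝕜) ^ j‖ ≤ 1 / K * ε := by
  set r := abelRadius K n
  have hr0 : 0 < r := abelRadius_pos K n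
  have hr1 : r < 1 := abelRadius_lt_one hK n
  have hr : r / (1 - r) ≤ (n + 1) / K := abelRadius_div_one_sub_le hK n
  calc _ ≤ ∑ j ∈ Ioc n N, 1 / (n + 1) * (‖e j‖ * r ^ j) := by
        refine norm_sum_le_of_le _ fun j hj => ?_
        have hj : (n : ℝ) + 1 ≤ j := by exact_mod_cast (mem_Ioc.1 hj).1
        rw [norm_mul, norm_div, RCLike.norm_natCast, norm_pow, RCLike.norm_of_nonneg hr0.le,
          ← mul_assoc, one_div_mul_eq_div]
        gcongr
    _ ≤ 1 / (n + 1) * (ε * (r / (1 - r))) := by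
        rw [← mul_sum]
        gcongr
        refine le_trans ?_ (sum_norm_mul_pow_le he hε hr0 hr1 N)
        rw [← sum_Icc_one_add_sum_Ioc _ hnN]
        exact le_add_of_nonneg_left (sum_nonneg fun j _ => by positivity)
    _ ≤ 1 / (n + 1) * (ε * ((n + 1) / K)) :=
        mul_le_mul_of_nonneg_left (mul_le_mul_of_nonneg_left hr hε) (by positivity)
    _ = 1 / K * ε := by field_simp

theorem norm_abelSum_sub_sum_le (he : ∀ n : ℕ, ∑ j ∈ Icc 1 n, ‖e j‖ ≤ n * ε) (hε : 0 ≤ ε)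
    (hK : 0 < K) {n N : ℕ} (hnN : n ≤ N) :
    ‖∑ j ∈ Icc 1 N, e j / j * (abelRadius K n : 𝕜) ^ j - ∑ j ∈ Icc 1 n, e j / j‖ ≤
      (K + 1 / K) * ε := by
  have hsplit : ∑ j ∈ Icc 1 N, e j / j * (abelRadius K n : 𝕜) ^ j - ∑ j ∈ Icc 1 n, e j / j =
      ∑ j ∈ Icc 1 n, e j / j * ((abelRadius K n : 𝕜) ^ j - 1) +
        ∑ j ∈ Ioc n N, e j / j * (abelRadius K n : 𝕜) ^ j := by
    simp only [mul_sub, mul_one, sum_sub_distrib]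
    rw [← sum_Icc_one_add_sum_Ioc _ hnN]
    ring
  rw [hsplit, add_mul]
  exact norm_add_le_of_le (norm_sum_div_mul_abelRadius_pow_sub_one_le he hε hK n)
    (norm_sum_Ioc_div_mul_abelRadius_pow_le he hε hK hnN)

end AbelPerturbation

section Holder

variable {E : Type*} [NormedAddCommGroup E] {a b s q ε γ : ℝ} {d : ℕ → ℝ} {e : ℕ → E}

theorem IsCesaroBounded.sum_norm_mul_rpow_le (he : IsCesaroBounded s ε e) (hε : 0 ≤ ε)
    (hsq : s.HolderConjugate q) {c : ℝ} (hc0 : 0 ≤ c) (hc : c * q < 1) (n : ℕ) :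
    ∑ i ∈ range n, ‖e (n - i)‖ * (((n : ℝ) + 1) / (i + 1)) ^ c ≤ n * ε / (1 - c * q) := by
  have hq := hsq.symm.pos
  have hcq : 0 < 1 - c * q := sub_pos.2 hc
  have hmean : ∑ i ∈ range n, ‖e (n - i)‖ ^ s ≤ n * ε ^ s := by
    rw [sum_range_sub_eq_sum_Icc_one fun j => ‖e j‖ ^ s]
    exact he n
  have hpower : ∑ i ∈ range n, ((((n : ℝ) + 1) / (i + 1)) ^ c) ^ q ≤ n / (1 - c * q) := by
    refine le_trans (le_of_eq ?_) (sum_div_rpow_le (mul_nonneg hc0 hq.le) hc n)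
    exact sum_congr rfl fun i _ => (Real.rpow_mul (by positivity) c q).symm
  have hinv : ((1 - c * q)⁻¹) ^ (1 / q) ≤ (1 - c * q)⁻¹ := by
    refine Real.rpow_le_self_of_one_le ?_ ?_
    · exact (one_le_inv₀ hcq).2 (by linarith [mul_nonneg hc0 hq.le])
    · rw [one_div]
      exact inv_le_one_of_one_le₀ hsq.symm.lt.le
  have hcard : (n : ℝ) ^ (1 / s) * (n : ℝ) ^ (1 / q) = n := by
    rw [← Real.rpow_add_of_nonneg n.cast_nonneg (one_div_nonneg.2 hsq.nonneg)
      (one_div_nonneg.2 hq.le), one_div, one_div, hsq.inv_add_inv_eq_one, Real.rpow_one]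
  calc _ ≤ (∑ i ∈ range n, ‖e (n - i)‖ ^ s) ^ (1 / s) *
        (∑ i ∈ range n, ((((n : ℝ) + 1) / (i + 1)) ^ c) ^ q) ^ (1 / q) :=
        Real.inner_le_Lp_mul_Lq_of_nonneg _ hsq (fun i _ => norm_nonneg _)
          fun i _ => by positivity
    _ ≤ (n * ε ^ s) ^ (1 / s) * (n / (1 - c * q)) ^ (1 / q) := by
        have := hsq.pos
        gcongr
    _ = (n : ℝ) ^ (1 / s) * (n : ℝ) ^ (1 / q) * ε * ((1 - c * q)⁻¹) ^ (1 / q) := by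
        rw [Real.mul_rpow n.cast_nonneg (by positivity), ← Real.rpow_mul hε,
          mul_one_div_cancel hsq.ne_zero, Real.rpow_one, div_eq_mul_inv (n : ℝ),
          Real.mul_rpow n.cast_nonneg (inv_nonneg.2 hcq.le)]
        ring
    _ ≤ n * ε / (1 - c * q) := by
        rw [hcard, div_eq_mul_inv]
        exact mul_le_mul_of_nonneg_left hinv (by positivity)

/-- The constant in the Hölder bound `IsCesaroBounded.sum_norm_mul_pCoeff_mul_rpow_le`. -/
noncomputable def holderConst (a b q γ : ℝ) : ℝ := (b + 1) / a / (1 - (1 - a + γ) * q)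

theorem IsCesaroBounded.sum_norm_mul_pCoeff_mul_rpow_le (he : IsCesaroBounded s ε e) (hε : 0 ≤ ε)
    (hsq : s.HolderConjugate q) (ha : 0 < a) (ha1 : a ≤ 1) (hlo : ∀ j, 1 ≤ j → a ≤ d j)
    (hhi : ∀ j, 1 ≤ j → d j ≤ b) (hγ0 : 0 ≤ γ) (hγ : (1 - a + γ) * q < 1) (n : ℕ) :
    ∑ i ∈ range n, ‖e (n - i)‖ * (pCoeff d i * (((n : ℝ) + 1) / (i + 1)) ^ γ) ≤
      holderConst a b q γ * ε * (n * pCoeff d n) := by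
  have hd : ∀ j, 1 ≤ j → 0 < d j := fun j hj => ha.trans_le (hlo j hj)
  have hb : 0 < b := (hd 1 le_rfl).trans_le (hhi 1 le_rfl)
  have hp := pCoeff_pos hd n
  calc _ ≤ ∑ i ∈ range n, (b + 1) / a * pCoeff d n *
        (‖e (n - i)‖ * (((n : ℝ) + 1) / (i + 1)) ^ (1 - a + γ)) := by
        refine sum_le_sum fun i hi => ?_
        have hu : 0 < ((n : ℝ) + 1) / (i + 1) := by positivity
        refine (mul_le_mul_of_nonneg_left (mul_le_mul_of_nonneg_right
          (pCoeff_le_mul_rpow ha ha1 hlo hhi (mem_range.1 hi).le) (by positivity))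
          (norm_nonneg _)).trans_eq ?_
        rw [Real.rpow_add hu]
        ring
    _ ≤ (b + 1) / a * pCoeff d n * (n * ε / (1 - (1 - a + γ) * q)) := by
        rw [← mul_sum]
        gcongr
        exact he.sum_norm_mul_rpow_le hε hsq (by linarith) hγ n
    _ = _ := by
        rw [holderConst]
        ring

theorem sum_pCoeff_mul_rpow_le (hsq : s.HolderConjugate q) (ha : 0 < a) (ha1 : a ≤ 1)
    (hlo : ∀ j, 1 ≤ j → a ≤ d j) (hhi : ∀ j, 1 ≤ j → d j ≤ b) (hγ0 : 0 ≤ γ)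
    (hγ : (1 - a + γ) * q < 1) (n : ℕ) :
    ∑ i ∈ range n, pCoeff d i * (((n : ℝ) + 1) / (i + 1)) ^ γ ≤
      holderConst a b q γ * (n * pCoeff d n) := by
  have hone : IsCesaroBounded s 1 fun _ => (1 : ℝ) := fun n => by simp
  simpa only [norm_one, one_mul, mul_one] using
    hone.sum_norm_mul_pCoeff_mul_rpow_le zero_le_one hsq ha ha1 hlo hhi hγ0 hγ n

end Holder

section ExpPartial

variable {ε : ℝ} {e : ℕ → ℂ} {i n : ℕ}

/-- The partial product `T_n = exp (∑_{j=1}^n e_j / j)`; up to a bounded factor it is the size of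
`M_n / p_n`. -/
noncomputable def expPartial (e : ℕ → ℂ) (n : ℕ) : ℂ := Complex.exp (∑ j ∈ Icc 1 n, e j / j)

theorem norm_expPartial_pos (e : ℕ → ℂ) (n : ℕ) : 0 < ‖expPartial e n‖ :=
  norm_pos_iff.2 (Complex.exp_ne_zero _)

theorem norm_exp_le_exp_norm_sub_mul (z w : ℂ) :
    ‖Complex.exp z‖ ≤ Real.exp ‖z - w‖ * ‖Complex.exp w‖ := by
  calc ‖Complex.exp z‖ = ‖Complex.exp (z - w)‖ * ‖Complex.exp w‖ := by
        rw [← norm_mul, ← Complex.exp_add, sub_add_cancel]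
    _ ≤ Real.exp ‖z - w‖ * ‖Complex.exp w‖ := by
        gcongr
        exact Complex.norm_exp_le_exp_norm _

theorem norm_sum_Icc_div_sub_le (he : ∀ n : ℕ, ∑ j ∈ Icc 1 n, ‖e j‖ ≤ n * ε) (hε : 0 ≤ ε)
    (hin : i ≤ n) : ‖∑ j ∈ Icc 1 n, e j / j - ∑ j ∈ Icc 1 i, e j / j‖ ≤
      ε * (1 + Real.log (((n : ℝ) + 1) / (i + 1))) := by
  rw [← sum_Icc_one_add_sum_Ioc _ hin, add_sub_cancel_left]
  refine (norm_sum_le_of_le _ fun j _ => ?_).trans (sum_Ioc_norm_div_le he hε hin)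
  rw [norm_div, Complex.norm_natCast]

theorem norm_expPartial_le_of_le (he : ∀ n : ℕ, ∑ j ∈ Icc 1 n, ‖e j‖ ≤ n * ε) (hε : 0 ≤ ε)
    {γ : ℝ} (hεγ : ε ≤ γ) (hγ0 : 0 < γ) (hγ1 : γ ≤ 1) (hin : i ≤ n) :
    ‖expPartial e i‖ ≤
      (1 + 3 * (ε / γ) * (((n : ℝ) + 1) / (i + 1)) ^ γ) * ‖expPartial e n‖ := by
  refine (norm_exp_le_exp_norm_sub_mul _ _).trans
    (mul_le_mul_of_nonneg_right ?_ (norm_expPartial_pos e n).le)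
  rw [norm_sub_rev]
  exact (Real.exp_le_exp.2 (norm_sum_Icc_div_sub_le he hε hin)).trans
    (exp_mul_one_add_log_le hε hεγ hγ0 hγ1 (by positivity))

theorem norm_expPartial_le_of_ge (he : ∀ n : ℕ, ∑ j ∈ Icc 1 n, ‖e j‖ ≤ n * ε) (hε : 0 ≤ ε)
    (hε3 : 3 * ε ≤ 1) (hni : n ≤ i) :
    ‖expPartial e i‖ ≤ 2 * (((i : ℝ) + 1) / (n + 1)) * ‖expPartial e n‖ := by
  refine (norm_exp_le_exp_norm_sub_mul _ _).trans
    (mul_le_mul_of_nonneg_right ?_ (norm_expPartial_pos e n).le)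
  have hu : 1 ≤ ((i : ℝ) + 1) / (n + 1) := by
    rw [one_le_div (by positivity)]
    exact_mod_cast Nat.succ_le_succ hni
  have hexp := exp_mul_one_add_log_le hε (by linarith) one_pos le_rfl (one_pos.trans_le hu)
  rw [Real.rpow_one, div_one] at hexp
  have hlin : 3 * ε * (((i : ℝ) + 1) / (n + 1)) ≤ 1 * (((i : ℝ) + 1) / (n + 1)) := by gcongr
  linarith [Real.exp_le_exp.2 (norm_sum_Icc_div_sub_le he hε hni)]

end ExpPartial

section AbelSumOfPerturbed

variable {b ε : ℝ} {d : ℕ → ℝ} {e : ℕ → ℂ} {N n : ℕ}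

theorem hasSum_expCoeff_add_mul_pow {x y : ℕ → ℂ} {z X Y : ℂ}
    (hx : HasSum (fun n => expCoeff x n * z ^ n) X)
    (hy : HasSum (fun n => expCoeff y n * z ^ n) Y) :
    HasSum (fun n => expCoeff (x + y) n * z ^ n) (X * Y) := by
  have hprod := hasSum_sum_range_mul_of_summable_norm hx.summable.norm hy.summable.norm
  rw [hx.tsum_eq, hy.tsum_eq] at hprod
  refine hprod.congr_fun fun n => ?_
  rw [expCoeff_add, sum_mul]
  refine sum_congr rfl fun i hi => ?_
  rw [mul_mul_mul_comm, ← pow_add, Nat.add_sub_cancel' (mem_range_succ_iff.1 hi)]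

/-- The coefficient `M_n` belonging to the exponents `d_j f̂(j) = d_j + e_j`. -/
noncomputable def perturbedCoeff (d : ℕ → ℝ) (e : ℕ → ℂ) (n : ℕ) : ℂ :=
  expCoeff ((fun j => (d j : ℂ)) + e) n

theorem sum_range_pCoeff_mul_abelRadius_pow_le_abelHead (hd : ∀ j, 1 ≤ j → 0 < d j)
    (hhi : ∀ j, 1 ≤ j → d j ≤ b) (hn : 1 ≤ n) (m : ℕ) :
    ∑ i ∈ range m, pCoeff d i * abelRadius (10 * b) n ^ i ≤ 5 / 4 * abelHead d (10 * b) n := by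
  have hp (i : ℕ) : 0 ≤ pCoeff d i * abelRadius (10 * b) n ^ i :=
    mul_nonneg (pCoeff_pos hd i).le (pow_nonneg (abelRadius_pos _ n).le i)
  have htail : ∑ i ∈ Ico n (n + m), pCoeff d i * abelRadius (10 * b) n ^ i ≤
      abelHead d (10 * b) n / 4 := by
    refine (sum_le_sum fun i hi => le_mul_of_one_le_left (hp i) ?_).trans
      (sum_Ico_pCoeff_mul_abelRadius_pow_le hd hhi hn (n + m))
    rw [one_le_div (by positivity)]
    exact_mod_cast Nat.succ_le_succ (mem_Ico.1 hi).1
  calc _ ≤ ∑ i ∈ range (n + m), pCoeff d i * abelRadius (10 * b) n ^ i :=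
        sum_le_sum_of_subset_of_nonneg (range_mono (Nat.le_add_left m n)) fun i _ _ => hp i
    _ = abelHead d (10 * b) n + ∑ i ∈ Ico n (n + m), pCoeff d i * abelRadius (10 * b) n ^ i :=
        (sum_range_add_sum_Ico _ (Nat.le_add_right n m)).symm
    _ ≤ _ := by linarith

theorem norm_exp_sum_mul_abelRadius_pow_le (he : ∀ n : ℕ, ∑ j ∈ Icc 1 n, ‖e j‖ ≤ n * ε)
    (hε : 0 ≤ ε) (hε1 : ε ≤ 1) {K : ℝ} (hK : 0 < K) (hnN : n ≤ N) :
    ‖Complex.exp (∑ j ∈ Icc 1 N, e j / j * (abelRadius K n : ℂ) ^ j)‖ ≤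
      Real.exp (K + 1 / K) * ‖expPartial e n‖ := by
  refine (norm_exp_le_exp_norm_sub_mul _ _).trans
    (mul_le_mul_of_nonneg_right ?_ (norm_expPartial_pos e n).le)
  exact Real.exp_le_exp.2 ((norm_abelSum_sub_sum_le he hε hK hnN).trans
    (mul_le_of_le_one_right (by positivity) hε1))

theorem exists_hasSum_perturbedCoeff_mul_abelRadius_pow (hd : ∀ j, 1 ≤ j → 0 < d j)
    (hhi : ∀ j, 1 ≤ j → d j ≤ b) (hN : ∀ j, N < j → e j = 0)
    (he : ∀ n : ℕ, ∑ j ∈ Icc 1 n, ‖e j‖ ≤ n * ε) (hε : 0 ≤ ε) (hε1 : ε ≤ 1) (hn : 1 ≤ n) :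
    ∃ S : ℂ, HasSum (fun i => perturbedCoeff d e i * (abelRadius (10 * b) n : ℂ) ^ i) S ∧
      ‖S‖ ≤ 5 / 4 * abelHead d (10 * b) n *
        (Real.exp (10 * b + 1 / (10 * b)) * ‖expPartial e n‖) := by
  have hb : 0 < b := (hd 1 le_rfl).trans_le (hhi 1 le_rfl)
  set r := abelRadius (10 * b) n
  have hp (i : ℕ) : 0 ≤ pCoeff d i * r ^ i :=
    mul_nonneg (pCoeff_pos hd i).le (pow_nonneg (abelRadius_pos _ n).le i)
  have hle := sum_range_pCoeff_mul_abelRadius_pow_le_abelHead hd hhi hn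
  have hP : HasSum (fun i => expCoeff (fun j => (d j : ℂ)) i * (r : ℂ) ^ i)
      ((∑' i, pCoeff d i * r ^ i : ℝ) : ℂ) := by
    refine (Complex.hasSum_ofReal.2 (summable_of_sum_range_le hp hle).hasSum).congr_fun
      fun i => ?_
    rw [expCoeff_ofReal]
    push_cast
    rfl
  have hE := hasSum_expCoeff (N := max N n)
    (fun j hj => hN j ((le_max_left N n).trans_lt hj)) (r : ℂ)
  refine ⟨_, hasSum_expCoeff_add_mul_pow hP hE, ?_⟩
  rw [norm_mul, Complex.norm_of_nonneg (tsum_nonneg hp)]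
  exact mul_le_mul (Real.tsum_le_of_sum_range_le hp hle)
    (norm_exp_sum_mul_abelRadius_pow_le he hε hε1 (by positivity) (le_max_right N n))
    (norm_nonneg _) (mul_nonneg (by norm_num) (sum_nonneg fun i _ => hp i))

end AbelSumOfPerturbed

section ComparisonSums

variable {a b s q γ ε Y : ℝ} {d : ℕ → ℝ} {e x : ℕ → ℂ} {n : ℕ}

theorem norm_sum_perturbation_mul_le (he : IsCesaroBounded s ε e) (hε : 0 ≤ ε)
    (hsq : s.HolderConjugate q) (ha : 0 < a) (ha1 : a ≤ 1) (hlo : ∀ j, 1 ≤ j → a ≤ d j)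
    (hhi : ∀ j, 1 ≤ j → d j ≤ b) (hγ0 : 0 < γ) (hγ1 : γ ≤ 1) (hεγ : 3 * ε ≤ γ)
    (hγ : (1 - a + γ) * q < 1) (hY : 0 ≤ Y)
    (hx : ∀ i, ‖x i‖ ≤ Y * (pCoeff d i * ‖expPartial e i‖)) (n : ℕ) :
    ‖∑ i ∈ range n, e (n - i) * x i‖ ≤
      2 * holderConst a b q γ * ε * Y * (n * pCoeff d n * ‖expPartial e n‖) := by
  have hp := fun i => (pCoeff_pos (fun j hj => ha.trans_le (hlo j hj)) i).le
  have hpartial {i : ℕ} (hin : i ≤ n) :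
      ‖expPartial e i‖ ≤ 2 * (((n : ℝ) + 1) / (i + 1)) ^ γ * ‖expPartial e n‖ := by
    refine (norm_expPartial_le_of_le (he.sum_norm_le hsq.lt.le hε) hε (by linarith) hγ0 hγ1
      hin).trans (mul_le_mul_of_nonneg_right ?_ (norm_nonneg _))
    have hu : 1 ≤ (((n : ℝ) + 1) / (i + 1)) ^ γ := by
      refine Real.one_le_rpow ?_ hγ0.le
      rw [one_le_div (by positivity)]
      exact_mod_cast Nat.succ_le_succ hin
    have hσ : 3 * (ε / γ) ≤ 1 := by rwa [← mul_div_assoc, div_le_one hγ0]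
    linarith [mul_le_of_le_one_left (zero_le_one.trans hu) hσ]
  calc _ ≤ ∑ i ∈ range n, 2 * Y * ‖expPartial e n‖ *
        (‖e (n - i)‖ * (pCoeff d i * (((n : ℝ) + 1) / (i + 1)) ^ γ)) := by
        refine norm_sum_le_of_le _ fun i hi => ?_
        rw [norm_mul]
        refine (mul_le_mul_of_nonneg_left ((hx i).trans (mul_le_mul_of_nonneg_left
          (mul_le_mul_of_nonneg_left (hpartial (mem_range.1 hi).le) (hp i)) hY))
          (norm_nonneg _)).trans_eq (by ring)
    _ ≤ 2 * Y * ‖expPartial e n‖ * (holderConst a b q γ * ε * (n * pCoeff d n)) := by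
        rw [← mul_sum]
        exact mul_le_mul_of_nonneg_left
          (he.sum_norm_mul_pCoeff_mul_rpow_le hε hsq ha ha1 hlo hhi hγ0.le hγ n) (by positivity)
    _ = _ := by ring

theorem sub_mul_abelRadius_pow_mem_Icc {t K : ℝ} (ha : 0 ≤ a) (hlo : a ≤ t) (hhi : t ≤ b)
    (hK : 0 < K) (n i : ℕ) : t - a * abelRadius K n ^ i ∈ Set.Icc 0 b := by
  have hr := (abelRadius_pos K n).le
  have hle : a * abelRadius K n ^ i ≤ a :=
    mul_le_of_le_one_right ha (pow_le_one₀ hr (abelRadius_lt_one hK n).le)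
  exact ⟨sub_nonneg.2 (hle.trans hlo),
    (sub_le_self _ (mul_nonneg ha (pow_nonneg hr i))).trans hhi⟩

theorem norm_sum_sub_mul_abelRadius_pow_mul_le (he : ∀ n : ℕ, ∑ j ∈ Icc 1 n, ‖e j‖ ≤ n * ε)
    (hε : 0 ≤ ε) (hsq : s.HolderConjugate q) (ha : 0 < a) (ha1 : a ≤ 1)
    (hlo : ∀ j, 1 ≤ j → a ≤ d j) (hhi : ∀ j, 1 ≤ j → d j ≤ b) (hγ0 : 0 < γ) (hγ1 : γ ≤ 1)
    (hεγ : ε ≤ γ) (hγ : (1 - a + γ) * q < 1) (hY : 0 ≤ Y)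
    (hx : ∀ i, ‖x i‖ ≤ Y * (pCoeff d i * ‖expPartial e i‖)) {K : ℝ} (hK : 0 < K) (n : ℕ) :
    ‖∑ i ∈ range n, ((d (n - i) : ℂ) - a * (abelRadius K n : ℂ) ^ i) * x i‖ ≤
      Y * ‖expPartial e n‖ * (n * pCoeff d n - a * abelHead d K n +
        3 * (ε / γ) * (b * (holderConst a b q γ * (n * pCoeff d n)))) := by
  have hd : ∀ j, 1 ≤ j → 0 < d j := fun j hj => ha.trans_le (hlo j hj)
  have hb : 0 < b := (hd 1 le_rfl).trans_le (hhi 1 le_rfl)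
  have hp := fun i => (pCoeff_pos hd i).le
  set u : ℕ → ℝ := fun i => ((n : ℝ) + 1) / (i + 1)
  calc _ ≤ ∑ i ∈ range n, Y * ‖expPartial e n‖ *
        ((d (n - i) * pCoeff d i - a * (pCoeff d i * abelRadius K n ^ i)) +
          3 * (ε / γ) * (b * (pCoeff d i * u i ^ γ))) := by
        refine norm_sum_le_of_le _ fun i hi => ?_
        have hin := mem_range.1 hi
        obtain ⟨hg0, hgb⟩ := sub_mul_abelRadius_pow_mem_Icc ha.le (hlo (n - i) (by omega))
          (hhi (n - i) (by omega)) hK n i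
        set g := d (n - i) - a * abelRadius K n ^ i with hg
        have hcast : (d (n - i) : ℂ) - a * (abelRadius K n : ℂ) ^ i = (g : ℂ) := by
          rw [hg]
          push_cast
          rfl
        rw [hcast, norm_mul, Complex.norm_of_nonneg hg0]
        calc g * ‖x i‖ ≤ g * (Y * (pCoeff d i *
              ((1 + 3 * (ε / γ) * u i ^ γ) * ‖expPartial e n‖))) := by
              refine mul_le_mul_of_nonneg_left ((hx i).trans (mul_le_mul_of_nonneg_left
                (mul_le_mul_of_nonneg_left ?_ (hp i)) hY)) hg0
              exact norm_expPartial_le_of_le he hε hεγ hγ0 hγ1 hin.le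
          _ = Y * ‖expPartial e n‖ *
                (g * pCoeff d i + 3 * (ε / γ) * (g * (pCoeff d i * u i ^ γ))) := by ring
          _ ≤ Y * ‖expPartial e n‖ *
                (g * pCoeff d i + 3 * (ε / γ) * (b * (pCoeff d i * u i ^ γ))) := by
              have := hp i
              gcongr
          _ = _ := by ring
    _ = Y * ‖expPartial e n‖ * (n * pCoeff d n - a * abelHead d K n +
          3 * (ε / γ) * (b * ∑ i ∈ range n, pCoeff d i * u i ^ γ)) := by
        rw [← mul_sum, sum_add_distrib, sum_sub_distrib, ← mul_pCoeff, ← mul_sum, ← mul_sum,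
          ← mul_sum]
        rfl
    _ ≤ _ := by
        have := sum_pCoeff_mul_rpow_le hsq ha ha1 hlo hhi hγ0.le hγ n
        gcongr

theorem norm_tsum_mul_abelRadius_pow_le (he : ∀ n : ℕ, ∑ j ∈ Icc 1 n, ‖e j‖ ≤ n * ε)
    (hε : 0 ≤ ε) (hε3 : 3 * ε ≤ 1) (hd : ∀ j, 1 ≤ j → 0 < d j) (hhi : ∀ j, 1 ≤ j → d j ≤ b)
    (hY : 0 ≤ Y) (hx : ∀ i, ‖x i‖ ≤ Y * (pCoeff d i * ‖expPartial e i‖)) (hn : 1 ≤ n) :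
    ‖∑' l, x (n + l) * (abelRadius (10 * b) n : ℂ) ^ (n + l)‖ ≤
      Y * ‖expPartial e n‖ * (abelHead d (10 * b) n / 2) := by
  set r := abelRadius (10 * b) n
  set t : ℕ → ℝ := fun l => (((n + l : ℕ) : ℝ) + 1) / (n + 1) * (pCoeff d (n + l) * r ^ (n + l))
    with ht
  have hr : 0 < r := abelRadius_pos _ n
  have hsum : Summable t := summable_pCoeff_mul_abelRadius_pow hd hhi hn
  have htsum : ∑' l, t l ≤ abelHead d (10 * b) n / 4 := hsum.tsum_le_of_sum_range_le
    (sum_range_pCoeff_mul_abelRadius_pow_le hd hhi hn)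
  refine (tsum_of_norm_bounded (hsum.hasSum.mul_left (2 * Y * ‖expPartial e n‖))
    fun l => ?_).trans ?_
  · rw [norm_mul, norm_pow, Complex.norm_of_nonneg hr.le]
    calc ‖x (n + l)‖ * r ^ (n + l) ≤ Y * (pCoeff d (n + l) *
          (2 * ((((n + l : ℕ) : ℝ) + 1) / (n + 1)) * ‖expPartial e n‖)) * r ^ (n + l) := by
          refine mul_le_mul_of_nonneg_right ((hx (n + l)).trans (mul_le_mul_of_nonneg_left
            (mul_le_mul_of_nonneg_left ?_ (pCoeff_pos hd _).le) hY)) (by positivity)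
          exact norm_expPartial_le_of_ge he hε hε3 (Nat.le_add_right n l)
      _ = _ := by
          rw [ht]
          ring
  · calc _ ≤ 2 * Y * ‖expPartial e n‖ * (abelHead d (10 * b) n / 4) := by gcongr
      _ = _ := by ring

end ComparisonSums

section Contraction

variable {a b s q γ ε Y : ℝ} {d : ℕ → ℝ} {e : ℕ → ℂ} {N n : ℕ}

theorem mul_perturbedCoeff (d : ℕ → ℝ) (e : ℕ → ℂ) (n : ℕ) :
    (n : ℂ) * perturbedCoeff d e n =
      ∑ i ∈ range n, ((d (n - i) : ℂ) + e (n - i)) * perturbedCoeff d e i :=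
  mul_expCoeff _ n

-- Subtracting `a` times the Abel sum is the point: its value is known, and what remains of the
-- main sum has total weight smaller than `n p_n` by a fixed factor.
theorem mul_perturbedCoeff_eq_of_hasSum (d : ℕ → ℝ) (e : ℕ → ℂ) (n : ℕ) {z S : ℂ} (a : ℂ)
    (hS : HasSum (fun i => perturbedCoeff d e i * z ^ i) S) :
    n * perturbedCoeff d e n =
      ∑ i ∈ range n, e (n - i) * perturbedCoeff d e i +
        ∑ i ∈ range n, ((d (n - i) : ℂ) - a * z ^ i) * perturbedCoeff d e i +
        a * (S - ∑' l, perturbedCoeff d e (n + l) * z ^ (n + l)) := by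
  have htail := hS.summable.sum_add_tsum_nat_add n
  rw [hS.tsum_eq] at htail
  simp only [add_comm n]
  rw [← htail, add_sub_cancel_right, mul_perturbedCoeff, mul_sum, ← sum_add_distrib,
    ← sum_add_distrib]
  exact sum_congr rfl fun i _ => by ring

/-- The relative gain from subtracting `a` times the Abel mean at `exp (-10 b / (n + 1))`. -/
noncomputable def contractionGain (a b : ℝ) : ℝ := a * Real.exp (-(10 * b)) / (2 * b)

theorem contractionGain_mul_le (hd : ∀ j, 1 ≤ j → 0 < d j) (hhi : ∀ j, 1 ≤ j → d j ≤ b)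
    (ha : 0 ≤ a) (n : ℕ) :
    contractionGain a b * (n * pCoeff d n) ≤ a * abelHead d (10 * b) n / 2 := by
  have hb : 0 < b := (hd 1 le_rfl).trans_le (hhi 1 le_rfl)
  have h := exp_neg_mul_le_mul_abelHead hd hhi (by positivity : 0 ≤ 10 * b) n
  calc contractionGain a b * (n * pCoeff d n) =
        a / (2 * b) * (Real.exp (-(10 * b)) * (n * pCoeff d n)) := by
        rw [contractionGain]
        ring
    _ ≤ a / (2 * b) * (b * abelHead d (10 * b) n) := by gcongr
    _ = a * abelHead d (10 * b) n / 2 := by field_simp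

theorem contractionGain_le_one (ha : 0 ≤ a) (hab : a ≤ b) (hb : 0 < b) :
    contractionGain a b ≤ 1 := by
  rw [contractionGain, div_le_one (by positivity)]
  have hexp : Real.exp (-(10 * b)) ≤ 1 := Real.exp_le_one_iff.2 (by linarith)
  linarith [mul_le_of_le_one_right ha hexp]

theorem mul_norm_perturbedCoeff_le (ha : 0 < a) (ha1 : a ≤ 1) (hlo : ∀ j, 1 ≤ j → a ≤ d j)
    (hhi : ∀ j, 1 ≤ j → d j ≤ b) (hN : ∀ j, N < j → e j = 0) (he : IsCesaroBounded s ε e)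
    (hε : 0 ≤ ε) (hsq : s.HolderConjugate q) (hγ0 : 0 < γ) (hγ1 : γ ≤ 1) (hεγ : 3 * ε ≤ γ)
    (hγ : (1 - a + γ) * q < 1) (hY : 0 ≤ Y)
    (hM : ∀ i, ‖perturbedCoeff d e i‖ ≤ Y * (pCoeff d i * ‖expPartial e i‖)) (hn : 1 ≤ n) :
    n * ‖perturbedCoeff d e n‖ ≤
      2 * holderConst a b q γ * ε * Y * (n * pCoeff d n * ‖expPartial e n‖) +
        Y * ‖expPartial e n‖ * (n * pCoeff d n - a * abelHead d (10 * b) n +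
          3 * (ε / γ) * (b * (holderConst a b q γ * (n * pCoeff d n)))) +
        a * (5 / 4 * abelHead d (10 * b) n *
            (Real.exp (10 * b + 1 / (10 * b)) * ‖expPartial e n‖) +
          Y * ‖expPartial e n‖ * (abelHead d (10 * b) n / 2)) := by
  have hd : ∀ j, 1 ≤ j → 0 < d j := fun j hj => ha.trans_le (hlo j hj)
  have hb : 0 < b := (hd 1 le_rfl).trans_le (hhi 1 le_rfl)
  have he1 := he.sum_norm_le hsq.lt.le hε
  obtain ⟨S, hS, hSle⟩ :=
    exists_hasSum_perturbedCoeff_mul_abelRadius_pow hd hhi hN he1 hε (by linarith) hn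
  have hnorm : n * ‖perturbedCoeff d e n‖ = ‖n * perturbedCoeff d e n‖ := by
    rw [norm_mul, Complex.norm_natCast]
  rw [hnorm, mul_perturbedCoeff_eq_of_hasSum d e n a hS]
  refine norm_add_le_of_le (norm_add_le_of_le
    (norm_sum_perturbation_mul_le he hε hsq ha ha1 hlo hhi hγ0 hγ1 hεγ hγ hY hM n)
    (norm_sum_sub_mul_abelRadius_pow_mul_le he1 hε hsq ha ha1 hlo hhi hγ0 hγ1 (by linarith) hγ
      hY hM (by positivity) n)) ?_
  rw [norm_mul, Complex.norm_of_nonneg ha.le]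
  exact mul_le_mul_of_nonneg_left (norm_sub_le_of_le hSle
    (norm_tsum_mul_abelRadius_pow_le he1 hε (by linarith) hd hhi hY hM hn)) ha.le

theorem norm_perturbedCoeff_le_of_forall_le (ha : 0 < a) (ha1 : a ≤ 1)
    (hlo : ∀ j, 1 ≤ j → a ≤ d j) (hhi : ∀ j, 1 ≤ j → d j ≤ b) (hN : ∀ j, N < j → e j = 0)
    (he : IsCesaroBounded s ε e) (hε : 0 ≤ ε) (hsq : s.HolderConjugate q) (hγ0 : 0 < γ)
    (hγ1 : γ ≤ 1) (hεγ : 3 * ε ≤ γ) (hγ : (1 - a + γ) * q < 1)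
    (hsmall : holderConst a b q γ * (2 * ε + 3 * (ε / γ) * b) ≤ contractionGain a b / 2)
    (hY : 0 ≤ Y)
    (hM : ∀ i, ‖perturbedCoeff d e i‖ ≤ Y * (pCoeff d i * ‖expPartial e i‖)) (n : ℕ) :
    ‖perturbedCoeff d e n‖ ≤ ((1 - contractionGain a b / 2) * Y +
      5 / 4 * Real.exp (10 * b + 1 / (10 * b))) * (pCoeff d n * ‖expPartial e n‖) := by
  have hd : ∀ j, 1 ≤ j → 0 < d j := fun j hj => ha.trans_le (hlo j hj)
  have hb : 0 < b := (hd 1 le_rfl).trans_le (hhi 1 le_rfl)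
  rcases n.eq_zero_or_pos with rfl | hn
  · have hgain := contractionGain_le_one ha.le ((hlo 1 le_rfl).trans (hhi 1 le_rfl)) hb
    have hexp : 1 ≤ Real.exp (10 * b + 1 / (10 * b)) := Real.one_le_exp (by positivity)
    have hY' : 0 ≤ (1 - contractionGain a b / 2) * Y := mul_nonneg (by linarith) hY
    simp only [perturbedCoeff, expCoeff_zero, pCoeff_zero, expPartial, Icc_eq_empty_of_lt one_pos,
      sum_empty, Complex.exp_zero, norm_one, mul_one]
    linarith
  · have hbound := mul_norm_perturbedCoeff_le ha ha1 hlo hhi hN he hε hsq hγ0 hγ1 hεγ hγ hY hM hn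
    have hYw : 0 ≤ Y * ‖expPartial e n‖ := by positivity
    have hD : 0 ≤ n * pCoeff d n := mul_nonneg n.cast_nonneg (pCoeff_pos hd n).le
    have hsmall' := mul_le_mul_of_nonneg_left (mul_le_mul_of_nonneg_right hsmall hD) hYw
    have hgain' := mul_le_mul_of_nonneg_left (contractionGain_mul_le hd hhi ha.le n) hYw
    have hhead := mul_le_mul_of_nonneg_left
      (mul_abelHead_le ha hlo (by positivity : 0 < 10 * b) n)
      (by positivity : 0 ≤ 5 / 4 * (Real.exp (10 * b + 1 / (10 * b)) * ‖expPartial e n‖))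
    refine le_of_mul_le_mul_left ?_ (Nat.cast_pos.2 hn : (0 : ℝ) < n)
    linarith

end Contraction

section Boundedness

variable {a b s q γ ε : ℝ} {d : ℕ → ℝ} {e : ℕ → ℂ} {N : ℕ}

theorem pCoeff_le_mul_two_pow (ha : 0 < a) (ha1 : a ≤ 1) (hlo : ∀ j, 1 ≤ j → a ≤ d j)
    (hhi : ∀ j, 1 ≤ j → d j ≤ b) {i n : ℕ} (hin : i ≤ n) :
    pCoeff d i ≤ (b + 1) / a * pCoeff d n * 2 ^ (n - i) := by
  have hd : ∀ j, 1 ≤ j → 0 < d j := fun j hj => ha.trans_le (hlo j hj)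
  have hb : 0 < b := (hd 1 le_rfl).trans_le (hhi 1 le_rfl)
  refine (pCoeff_le_mul_rpow ha ha1 hlo hhi hin).trans (mul_le_mul_of_nonneg_left ?_
    (mul_nonneg (by positivity) (pCoeff_pos hd n).le))
  have hone : 1 ≤ ((n : ℝ) + 1) / (i + 1) := by
    rw [one_le_div (by positivity)]
    exact_mod_cast Nat.succ_le_succ hin
  calc (((n : ℝ) + 1) / (i + 1)) ^ (1 - a) ≤ (((n : ℝ) + 1) / (i + 1)) ^ (1 : ℝ) :=
        Real.rpow_le_rpow_of_exponent_le hone (by linarith)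
    _ ≤ 2 ^ (n - i) := by
        rw [Real.rpow_one, div_le_iff₀ (by positivity)]
        obtain ⟨k, rfl⟩ := Nat.exists_eq_add_of_le hin
        rw [Nat.add_sub_cancel_left]
        have hk : k + 1 ≤ 2 ^ k := Nat.lt_two_pow_self
        have : i + k + 1 ≤ 2 ^ k * (i + 1) := by nlinarith
        exact_mod_cast this

theorem norm_perturbedCoeff_le_mul_tsum (ha : 0 < a) (ha1 : a ≤ 1) (hlo : ∀ j, 1 ≤ j → a ≤ d j)
    (hhi : ∀ j, 1 ≤ j → d j ≤ b) (hN : ∀ j, N < j → e j = 0) (n : ℕ) :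
    ‖perturbedCoeff d e n‖ ≤ (b + 1) / a * (∑' k, ‖expCoeff e k * 2 ^ k‖) * pCoeff d n := by
  have hd : ∀ j, 1 ≤ j → 0 < d j := fun j hj => ha.trans_le (hlo j hj)
  have hb : 0 < b := (hd 1 le_rfl).trans_le (hhi 1 le_rfl)
  have hp := pCoeff_pos hd n
  have hsum : Summable fun k => ‖expCoeff e k * 2 ^ k‖ := (hasSum_expCoeff hN 2).summable.norm
  calc ‖perturbedCoeff d e n‖ ≤ ∑ i ∈ range (n + 1),
        (b + 1) / a * pCoeff d n * ‖expCoeff e (n - i) * 2 ^ (n - i)‖ := by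
        rw [perturbedCoeff, expCoeff_add]
        refine norm_sum_le_of_le _ fun i hi => ?_
        rw [expCoeff_ofReal, norm_mul, Complex.norm_of_nonneg (pCoeff_pos hd i).le, norm_mul,
          norm_pow, Complex.norm_two, mul_comm ‖expCoeff e (n - i)‖, ← mul_assoc]
        exact mul_le_mul_of_nonneg_right
          (pCoeff_le_mul_two_pow ha ha1 hlo hhi (mem_range_succ_iff.1 hi)) (norm_nonneg _)
    _ = (b + 1) / a * pCoeff d n * ∑ k ∈ range (n + 1), ‖expCoeff e k * 2 ^ k‖ := by
        rw [← mul_sum, ← sum_range_reflect fun k => ‖expCoeff e k * 2 ^ k‖]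
        rfl
    _ ≤ (b + 1) / a * pCoeff d n * ∑' k, ‖expCoeff e k * 2 ^ k‖ := by
        gcongr
        exact hsum.sum_le_tsum _ fun k _ => norm_nonneg _
    _ = _ := by ring

theorem one_le_exp_tsum_mul_norm_expPartial (hN : ∀ j, N < j → e j = 0) (n : ℕ) :
    1 ≤ Real.exp (∑' j, ‖e j / j‖) * ‖expPartial e n‖ := by
  have hsum : Summable fun j => ‖e j / j‖ :=
    summable_of_ne_finset_zero (s := range (N + 1)) fun j hj => by
      rw [hN j (by simpa using hj), zero_div, norm_zero]
  have h := norm_exp_le_exp_norm_sub_mul 0 (∑ j ∈ Icc 1 n, e j / j)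
  rw [Complex.exp_zero, norm_one, zero_sub, norm_neg] at h
  refine h.trans (mul_le_mul_of_nonneg_right (Real.exp_le_exp.2 ?_) (norm_nonneg _))
  exact (norm_sum_le _ _).trans (hsum.sum_le_tsum _ fun j _ => norm_nonneg _)

theorem bddAbove_norm_perturbedCoeff_div (ha : 0 < a) (ha1 : a ≤ 1)
    (hlo : ∀ j, 1 ≤ j → a ≤ d j) (hhi : ∀ j, 1 ≤ j → d j ≤ b) (hN : ∀ j, N < j → e j = 0) :
    BddAbove (Set.range fun n =>
      ‖perturbedCoeff d e n‖ / (pCoeff d n * ‖expPartial e n‖)) := by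
  have hd : ∀ j, 1 ≤ j → 0 < d j := fun j hj => ha.trans_le (hlo j hj)
  have hb : 0 < b := (hd 1 le_rfl).trans_le (hhi 1 le_rfl)
  set G := (b + 1) / a * ∑' k, ‖expCoeff e k * 2 ^ k‖
  have : 0 ≤ G := mul_nonneg (by positivity) (tsum_nonneg fun k => norm_nonneg _)
  refine ⟨G * Real.exp (∑' j, ‖e j / j‖), Set.forall_mem_range.2 fun n => ?_⟩
  have hp := pCoeff_pos hd n
  rw [div_le_iff₀ (mul_pos hp (norm_expPartial_pos e n))]
  calc ‖perturbedCoeff d e n‖ ≤ G * pCoeff d n :=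
        norm_perturbedCoeff_le_mul_tsum ha ha1 hlo hhi hN n
    _ ≤ G * pCoeff d n * (Real.exp (∑' j, ‖e j / j‖) * ‖expPartial e n‖) :=
        le_mul_of_one_le_right (by positivity) (one_le_exp_tsum_mul_norm_expPartial hN n)
    _ = _ := by ring

theorem norm_perturbedCoeff_le (ha : 0 < a) (ha1 : a ≤ 1)
    (hlo : ∀ j, 1 ≤ j → a ≤ d j) (hhi : ∀ j, 1 ≤ j → d j ≤ b) (hN : ∀ j, N < j → e j = 0)
    (he : IsCesaroBounded s ε e) (hε : 0 ≤ ε) (hsq : s.HolderConjugate q) (hγ0 : 0 < γ)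
    (hγ1 : γ ≤ 1) (hεγ : 3 * ε ≤ γ) (hγ : (1 - a + γ) * q < 1)
    (hsmall : holderConst a b q γ * (2 * ε + 3 * (ε / γ) * b) ≤ contractionGain a b / 2) (n : ℕ) :
    ‖perturbedCoeff d e n‖ ≤ 5 / 2 * Real.exp (10 * b + 1 / (10 * b)) / contractionGain a b *
      (pCoeff d n * ‖expPartial e n‖) := by
  have hd : ∀ j, 1 ≤ j → 0 < d j := fun j hj => ha.trans_le (hlo j hj)
  have hb : 0 < b := (hd 1 le_rfl).trans_le (hhi 1 le_rfl)
  have hgain : 0 < contractionGain a b := by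
    rw [contractionGain]
    positivity
  have hw (n : ℕ) : 0 < pCoeff d n * ‖expPartial e n‖ :=
    mul_pos (pCoeff_pos hd n) (norm_expPartial_pos e n)
  set ratio : ℕ → ℝ := fun n => ‖perturbedCoeff d e n‖ / (pCoeff d n * ‖expPartial e n‖)
  have hratio : ∀ n, ratio n ≤ ⨆ n, ratio n :=
    le_ciSup (bddAbove_norm_perturbedCoeff_div ha ha1 hlo hhi hN)
  have hsup : ⨆ n, ratio n ≤ (1 - contractionGain a b / 2) * (⨆ n, ratio n) +
      5 / 4 * Real.exp (10 * b + 1 / (10 * b)) := ciSup_le fun n => by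
    rw [div_le_iff₀ (hw n)]
    exact norm_perturbedCoeff_le_of_forall_le ha ha1 hlo hhi hN he hε hsq hγ0 hγ1 hεγ hγ hsmall
      (le_trans (div_nonneg (norm_nonneg _) (hw 0).le) (hratio 0))
      (fun i => (div_le_iff₀ (hw i)).1 (hratio i)) n
  rw [← div_le_iff₀ (hw n)]
  refine (hratio n).trans ?_
  rw [le_div_iff₀ hgain]
  linarith

theorem exists_holderConjugate_of_one_div_lt (ha : 0 < a) (ha1 : a ≤ 1) (hs : 1 / a < s) :
    ∃ q γ : ℝ, s.HolderConjugate q ∧ 0 < γ ∧ γ ≤ 1 ∧ (1 - a + γ) * q < 1 := by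
  have hs1 : 1 < s := ((one_le_div ha).2 ha1).trans_lt hs
  have hinv : 1 / s < a := (one_div_lt ha (one_pos.trans hs1)).1 hs
  have hsq := Real.HolderConjugate.conjExponent hs1
  refine ⟨_, (a - 1 / s) / 2, hsq, by linarith,
    by linarith [one_div_pos.2 (one_pos.trans hs1)], ?_⟩
  have hq : 1 / s.conjExponent = 1 - 1 / s := by rw [one_div, one_div, ← hsq.one_sub_inv]
  rw [← lt_div_iff₀ hsq.symm.pos, hq]
  linarith

theorem perturbedCoeff_indicator_Iic (d : ℕ → ℝ) (e : ℕ → ℂ) (n : ℕ) :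
    perturbedCoeff d ((Set.Iic n).indicator e) n = perturbedCoeff d e n :=
  expCoeff_congr fun j hj =>
    congrArg ((d j : ℂ) + ·) (Set.indicator_of_mem (Set.mem_Iic.2 (mem_Icc.1 hj).2) e)

theorem expPartial_indicator_Iic (e : ℕ → ℂ) (n : ℕ) :
    expPartial ((Set.Iic n).indicator e) n = expPartial e n :=
  congrArg Complex.exp <| sum_congr rfl fun j hj =>
    congrArg (· / (j : ℂ)) (Set.indicator_of_mem (Set.mem_Iic.2 (mem_Icc.1 hj).2) e)

theorem exists_forall_norm_perturbedCoeff_le (ha : 0 < a) (ha1 : a ≤ 1) (hb : 0 < b)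
    (hs : 1 / a < s) : ∃ δ > 0, ∃ B > 0, ∀ {d : ℕ → ℝ} {e : ℕ → ℂ} {ε : ℝ},
      (∀ j, 1 ≤ j → a ≤ d j) → (∀ j, 1 ≤ j → d j ≤ b) → IsCesaroBounded s ε e → 0 ≤ ε → ε ≤ δ →
        ∀ n, ‖perturbedCoeff d e n‖ ≤ B * (pCoeff d n * ‖expPartial e n‖) := by
  obtain ⟨q, γ, hsq, hγ0, hγ1, hγ⟩ := exists_holderConjugate_of_one_div_lt ha ha1 hs
  have hgain : 0 < contractionGain a b := by
    rw [contractionGain]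
    positivity
  have hconst : 0 < holderConst a b q γ := by
    have := sub_pos.2 hγ
    rw [holderConst]
    positivity
  refine ⟨min (γ / 3) (contractionGain a b / (2 * (holderConst a b q γ * (2 + 3 * b / γ)))),
    by positivity, 5 / 2 * Real.exp (10 * b + 1 / (10 * b)) / contractionGain a b,
    by positivity, fun {_ e ε} hlo hhi he hε hδ n => ?_⟩
  have htrunc : IsCesaroBounded s ε ((Set.Iic n).indicator e) := by
    have := he.of_norm_le_mul hsq.nonneg hε zero_le_one (x := (Set.Iic n).indicator e) fun j _ => by
      rw [one_mul]
      exact norm_indicator_le_norm_self e j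
    rwa [one_mul] at this
  have hδ' := hδ.trans (min_le_right _ _)
  rw [le_div_iff₀ (by positivity)] at hδ'
  rw [← perturbedCoeff_indicator_Iic, ← expPartial_indicator_Iic]
  refine norm_perturbedCoeff_le ha ha1 hlo hhi
    (fun j hj => Set.indicator_of_notMem (Set.notMem_Iic.2 hj) e) htrunc hε hsq hγ0 hγ1
    (by linarith [hδ.trans (min_le_left _ _)]) hγ ?_ n
  linarith [show holderConst a b q γ * (2 * ε + 3 * (ε / γ) * b) =
      ε * (2 * (holderConst a b q γ * (2 + 3 * b / γ))) / 2 by ring]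

end Boundedness

section SecondOrder

theorem norm_sub_sub_smul_deriv_le {E : Type*} [NormedAddCommGroup E] [NormedSpace ℂ E]
    {Φ : ℂ → E} {c z : ℂ} {R B : ℝ} (hΦ : DiffContOnCl ℂ Φ (Metric.ball c R))
    (hz : z ∈ Metric.ball c R) (hB : ∀ w, ‖w - c‖ ≤ R → ‖Φ w‖ ≤ B) :
    ‖Φ z - Φ c - (z - c) • deriv Φ c‖ ≤ 3 * B * (‖z - c‖ / R) ^ 2 := by
  have hR : 0 < R := Metric.nonempty_ball.1 ⟨z, hz⟩
  have hderiv : ‖deriv Φ c‖ ≤ B / R :=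
    Complex.norm_deriv_le_of_forall_mem_sphere_norm_le hR hΦ
      fun w hw => hB w (mem_sphere_iff_norm.1 hw).le
  set g : ℂ → E := fun w => Φ w - (w - c) • deriv Φ c with hg
  have hgc : g c = Φ c := by simp [hg]
  have hmaps : Set.MapsTo g (Metric.ball c R) (Metric.closedBall (g c) (3 * B)) := fun w hw => by
    have hw' := (mem_ball_iff_norm.1 hw).le
    have hlin : ‖(w - c) • deriv Φ c‖ ≤ B := by
      rw [norm_smul]
      exact (mul_le_mul hw' hderiv (norm_nonneg _) hR.le).trans_eq (by field_simp)
    rw [mem_closedBall_iff_norm, hgc]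
    linarith [norm_sub_le (g w) (Φ c), norm_sub_le (Φ w) ((w - c) • deriv Φ c), hB w hw',
      hB c (by rw [sub_self, norm_zero]; exact hR.le)]
  have hlittle : (g · - g c) =o[nhds c] fun w : ℂ => ‖w - c‖ ^ 1 := by
    simp only [pow_one, Asymptotics.isLittleO_norm_right, hgc]
    refine (hasDerivAt_iff_isLittleO.1 (hΦ.differentiableAt Metric.isOpen_ball
      (Metric.mem_ball_self hR)).hasDerivAt).congr_left fun w => ?_
    rw [hg, sub_right_comm]
  have hgd : DifferentiableOn ℂ g (Metric.ball c R) :=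
    hΦ.differentiableOn.sub (by fun_prop)
  have hschwarz :=
    Complex.dist_le_mul_div_pow_of_mapsTo_ball_of_isLittleO hgd hmaps hlittle hz
  rwa [dist_eq_norm, dist_eq_norm, hgc, hg, sub_right_comm] at hschwarz

theorem norm_sub_sub_deriv_le {E : Type*} [NormedAddCommGroup E] [NormedSpace ℂ E] {Φ : ℂ → E}
    (hΦ : Differentiable ℂ Φ) {B t : ℝ} (ht0 : 0 ≤ t) (ht1 : t < 1)
    (hB : ∀ z, ‖z‖ * t ≤ 1 → ‖Φ z‖ ≤ B) : ‖Φ 1 - Φ 0 - deriv Φ 0‖ ≤ 3 * B * t ^ 2 := by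
  rcases ht0.eq_or_lt with rfl | ht
  · have hbdd : Bornology.IsBounded (Set.range Φ) :=
      isBounded_iff_forall_norm_le.2 ⟨B, Set.forall_mem_range.2 fun z => hB z (by simp)⟩
    obtain ⟨c, hc⟩ := hΦ.exists_const_forall_eq_of_bounded hbdd
    simp [funext hc]
  · have hone : (1 : ℂ) ∈ Metric.ball 0 t⁻¹ := by simpa using (one_lt_inv₀ ht).2 ht1
    simpa using norm_sub_sub_smul_deriv_le hΦ.diffContOnCl hone fun w hw =>
      hB w ((le_div_iff₀ ht).1 (by simpa using hw))

theorem differentiable_expCoeff_smul (e : ℕ → ℂ) (k : ℕ) :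
    Differentiable ℂ fun w : ℂ => expCoeff (w • e) k := by
  induction k using Nat.strong_induction_on with
  | _ k ih =>
    rcases eq_or_ne k 0 with rfl | hk
    · simp only [expCoeff_zero]
      exact differentiable_const 1
    · have hrec : (fun w : ℂ => expCoeff (w • e) k) =
          fun w => (∑ i ∈ range k, (w • e) (k - i) * expCoeff (w • e) i) / k := funext fun w => by
        rw [← mul_expCoeff, mul_div_cancel_left₀ _ (Nat.cast_ne_zero.2 hk)]
      rw [hrec]
      exact (Differentiable.fun_sum fun i hi =>
        (differentiable_id.mul_const _).mul (ih i (mem_range.1 hi))).div_const _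

theorem expCoeff_zero_left {K : Type*} [Field K] [CharZero K] {k : ℕ} (hk : k ≠ 0) :
    expCoeff (0 : ℕ → K) k = 0 := by
  have := mul_expCoeff (0 : ℕ → K) k
  simpa [hk] using this

theorem hasDerivAt_expCoeff_smul (e : ℕ → ℂ) (k : ℕ) :
    HasDerivAt (fun w : ℂ => expCoeff (w • e) k) (e k / k) 0 := by
  rcases eq_or_ne k 0 with rfl | hk
  · simp only [expCoeff_zero, Nat.cast_zero, div_zero]
    exact hasDerivAt_const 0 1
  set H : ℂ → ℂ := fun w => (∑ i ∈ range k, e (k - i) * expCoeff (w • e) i) / k with hH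
  have hHd : Differentiable ℂ H := (Differentiable.fun_sum fun i _ =>
    (differentiable_expCoeff_smul e i).const_mul _).div_const _
  have hfactor : (fun w : ℂ => expCoeff (w • e) k) = fun w => w * H w := funext fun w => by
    rw [hH, ← mul_div_assoc, eq_div_iff (Nat.cast_ne_zero.2 hk), mul_comm, mul_expCoeff, mul_sum]
    exact sum_congr rfl fun i _ => mul_assoc w _ _
  have hH0 : H 0 = e k / k := by
    simp only [hH, zero_smul]
    rw [sum_eq_single_of_mem 0 (mem_range.2 (Nat.pos_of_ne_zero hk)) fun i _ hi => by
      rw [expCoeff_zero_left hi, mul_zero], expCoeff_zero, Nat.sub_zero, mul_one]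
  rw [hfactor, ← hH0]
  exact ((hasDerivAt_id' (0 : ℂ)).fun_mul (hHd 0).hasDerivAt).congr_deriv (by simp)

theorem perturbedCoeff_eq_sum (d : ℕ → ℝ) (e : ℕ → ℂ) (n : ℕ) :
    perturbedCoeff d e n = ∑ j ∈ range (n + 1), expCoeff e j * (pCoeff d (n - j) : ℂ) := by
  rw [perturbedCoeff, add_comm, expCoeff_add]
  simp only [expCoeff_ofReal]

theorem perturbedCoeff_zero (d : ℕ → ℝ) (n : ℕ) : perturbedCoeff d 0 n = pCoeff d n := by
  rw [perturbedCoeff, add_zero, expCoeff_ofReal]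

theorem differentiable_perturbedCoeff_smul (d : ℕ → ℝ) (e : ℕ → ℂ) (n : ℕ) :
    Differentiable ℂ fun w : ℂ => perturbedCoeff d (w • e) n := by
  simp only [perturbedCoeff_eq_sum]
  exact Differentiable.fun_sum fun j _ => (differentiable_expCoeff_smul e j).mul_const _

theorem hasDerivAt_perturbedCoeff_smul (d : ℕ → ℝ) (e : ℕ → ℂ) (n : ℕ) :
    HasDerivAt (fun w : ℂ => perturbedCoeff d (w • e) n)
      (∑ j ∈ Icc 1 n, e j / j * (pCoeff d (n - j) : ℂ)) 0 := by
  simp only [perturbedCoeff_eq_sum]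
  refine (HasDerivAt.fun_sum fun j _ =>
    (hasDerivAt_expCoeff_smul e j).mul_const _).congr_deriv ?_
  rw [sum_range_succ', Nat.cast_zero, div_zero, zero_mul, add_zero,
    sum_Icc_one_eq_sum_range fun j => e j / j * (pCoeff d (n - j) : ℂ)]

theorem expPartial_smul (w : ℂ) (e : ℕ → ℂ) (n : ℕ) :
    expPartial (w • e) n = Complex.exp (w * ∑ j ∈ Icc 1 n, e j / j) := by
  rw [expPartial, mul_sum]
  exact congrArg _ (sum_congr rfl fun j _ => mul_div_assoc w _ _)

/-- The ratio `M_n / (p_n T_n)`, which the theorem expands to second order in `e`. -/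
noncomputable def normalizedCoeff (d : ℕ → ℝ) (e : ℕ → ℂ) (n : ℕ) : ℂ :=
  perturbedCoeff d e n / (pCoeff d n * expPartial e n)

theorem normalizedCoeff_smul (d : ℕ → ℝ) (e : ℕ → ℂ) (n : ℕ) (w : ℂ) :
    normalizedCoeff d (w • e) n =
      perturbedCoeff d (w • e) n / pCoeff d n * Complex.exp (-(w * ∑ j ∈ Icc 1 n, e j / j)) := by
  rw [normalizedCoeff, expPartial_smul, Complex.exp_neg, ← div_div,
    div_eq_mul_inv _ (Complex.exp _)]

theorem differentiable_normalizedCoeff_smul (d : ℕ → ℝ) (e : ℕ → ℂ) (n : ℕ) :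
    Differentiable ℂ fun w : ℂ => normalizedCoeff d (w • e) n := by
  simp only [normalizedCoeff_smul]
  exact ((differentiable_perturbedCoeff_smul d e n).div_const _).mul (by fun_prop)

theorem normalizedCoeff_zero {d : ℕ → ℝ} (hd : ∀ j, 1 ≤ j → 0 < d j) (n : ℕ) :
    normalizedCoeff d 0 n = 1 := by
  have hp : (pCoeff d n : ℂ) ≠ 0 := Complex.ofReal_ne_zero.2 (pCoeff_pos hd n).ne'
  simp [normalizedCoeff, perturbedCoeff_zero, expPartial, hp]

theorem hasDerivAt_normalizedCoeff_smul {d : ℕ → ℝ} (hd : ∀ j, 1 ≤ j → 0 < d j) (e : ℕ → ℂ)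
    (n : ℕ) : HasDerivAt (fun w : ℂ => normalizedCoeff d (w • e) n)
      (∑ j ∈ Icc 1 n, e j / j * ((pCoeff d (n - j) / pCoeff d n - 1 : ℝ) : ℂ)) 0 := by
  have hp : (pCoeff d n : ℂ) ≠ 0 := Complex.ofReal_ne_zero.2 (pCoeff_pos hd n).ne'
  set L := ∑ j ∈ Icc 1 n, e j / j with hL
  have hexp : HasDerivAt (fun w : ℂ => Complex.exp (-(w * L))) (-L) 0 := by
    simpa using ((hasDerivAt_id (0 : ℂ)).mul_const L).neg.cexp
  have hsum : (∑ j ∈ Icc 1 n, e j / j * (pCoeff d (n - j) : ℂ)) / pCoeff d n - L =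
      ∑ j ∈ Icc 1 n, e j / j * ((pCoeff d (n - j) / pCoeff d n - 1 : ℝ) : ℂ) := by
    rw [hL, sum_div, ← sum_sub_distrib]
    refine sum_congr rfl fun j _ => ?_
    push_cast
    ring
  simp only [normalizedCoeff_smul]
  refine (((hasDerivAt_perturbedCoeff_smul d e n).div_const _).fun_mul hexp).congr_deriv ?_
  rw [← hsum, zero_smul, perturbedCoeff_zero, div_self hp]
  simp [sub_eq_add_neg]

theorem exists_forall_norm_normalizedCoeff_sub_le {a b s : ℝ} (ha : 0 < a) (ha1 : a ≤ 1)
    (hb : 0 < b) (hs : 1 / a < s) :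
    ∃ δ > 0, ∃ C > 0, ∀ {d : ℕ → ℝ} {e : ℕ → ℂ} {ε : ℝ},
      (∀ j, 1 ≤ j → a ≤ d j) → (∀ j, 1 ≤ j → d j ≤ b) → IsCesaroBounded s ε e → 0 ≤ ε → ε ≤ δ →
        ∀ n, ‖normalizedCoeff d e n - 1 -
          ∑ j ∈ Icc 1 n, e j / j * ((pCoeff d (n - j) / pCoeff d n - 1 : ℝ) : ℂ)‖ ≤ C * ε ^ 2 := by
  obtain ⟨δ, hδ, B, hB, hbound⟩ := exists_forall_norm_perturbedCoeff_le ha ha1 hb hs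
  refine ⟨δ / 2, by positivity, 3 * B / δ ^ 2, by positivity,
    fun {d e ε} hlo hhi he hε hεδ n => ?_⟩
  have hs0 : 0 ≤ s := (one_div_pos.2 ha).le.trans hs.le
  have hd : ∀ j, 1 ≤ j → 0 < d j := fun j hj => ha.trans_le (hlo j hj)
  have hnorm (w : ℂ) (hw : ‖w‖ * (ε / δ) ≤ 1) : ‖normalizedCoeff d (w • e) n‖ ≤ B := by
    rw [← mul_div_assoc, div_le_one hδ] at hw
    have hwe : IsCesaroBounded s (‖w‖ * ε) (w • e) :=
      he.of_norm_le_mul hs0 hε (norm_nonneg w) fun j _ => (norm_smul w (e j)).le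
    rw [normalizedCoeff, norm_div, norm_mul, Complex.norm_of_nonneg (pCoeff_pos hd n).le,
      div_le_iff₀ (mul_pos (pCoeff_pos hd n) (norm_expPartial_pos _ n))]
    exact hbound hlo hhi hwe (by positivity) hw n
  have hschwarz := norm_sub_sub_deriv_le (differentiable_normalizedCoeff_smul d e n)
    (div_nonneg hε hδ.le) ((div_lt_one hδ).2 (by linarith)) hnorm
  rw [(hasDerivAt_normalizedCoeff_smul hd e n).deriv, one_smul, zero_smul,
    normalizedCoeff_zero hd] at hschwarz
  exact hschwarz.trans_eq (by rw [div_pow]; ring)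

end SecondOrder

section Rho

theorem sum_norm_rpow_div_le_rho {f : ℕ → ℂ} {p : ℝ≥0∞} (hp : p ≠ ∞) (hp0 : 0 < p.toReal)
    (hf : rho f p ≠ ∞) (n : ℕ) :
    ∑ j ∈ Icc 1 n, ‖f j - 1‖ ^ p.toReal / j ≤ (rho f p).toReal ^ p.toReal := by
  set s := p.toReal
  have hrho : rho f p ^ s = ∑' j : ℕ, ‖f (j + 1) - 1‖ₑ ^ s / ((j + 1 : ℕ) : ℝ≥0∞) := by
    rw [rho, if_neg hp, ← ENNReal.rpow_mul, one_div_mul_cancel hp0.ne', ENNReal.rpow_one]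
  have hpartial : ENNReal.ofReal (∑ j ∈ Icc 1 n, ‖f j - 1‖ ^ s / j) ≤ rho f p ^ s := by
    rw [hrho, ENNReal.ofReal_sum_of_nonneg fun j _ => by positivity,
      sum_Icc_one_eq_sum_range fun j => ENNReal.ofReal (‖f j - 1‖ ^ s / j)]
    refine (sum_congr rfl fun j _ => ?_).trans_le (ENNReal.sum_le_tsum (range n))
    rw [ENNReal.ofReal_div_of_pos (by positivity), ← ENNReal.ofReal_rpow_of_nonneg (norm_nonneg _)
      hp0.le, ofReal_norm, ENNReal.ofReal_natCast]
  rw [ENNReal.toReal_rpow]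
  exact (ENNReal.ofReal_le_iff_le_toReal (ENNReal.rpow_ne_top_of_nonneg hp0.le hf)).1 hpartial

theorem norm_sub_one_le_rho_top {f : ℕ → ℂ} (hf : rho f ∞ ≠ ∞) {j : ℕ} (hj : 1 ≤ j) :
    ‖f j - 1‖ ≤ (rho f ∞).toReal := by
  have hle : ‖f j - 1‖ₑ ≤ rho f ∞ := by
    rw [rho, if_pos rfl]
    simpa only [Nat.sub_add_cancel hj] using le_iSup (fun j : ℕ => ‖f (j + 1) - 1‖ₑ) (j - 1)
  simpa only [toReal_enorm] using ENNReal.toReal_mono hf hle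

theorem isCesaroBounded_sub_one_of_ne_top {f : ℕ → ℂ} {p : ℝ≥0∞} (hp : p ≠ ∞)
    (hp0 : 0 < p.toReal) (hf : rho f p ≠ ∞) :
    IsCesaroBounded p.toReal (rho f p).toReal fun j => f j - 1 := fun n => by
  calc ∑ j ∈ Icc 1 n, ‖f j - 1‖ ^ p.toReal ≤ ∑ j ∈ Icc 1 n, n * (‖f j - 1‖ ^ p.toReal / j) :=
        sum_le_sum fun j hj => by
          obtain ⟨hj1, hjn⟩ := mem_Icc.1 hj
          have hj0 : (0 : ℝ) < j := Nat.cast_pos.2 hj1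
          rw [← mul_div_assoc, le_div_iff₀ hj0, mul_comm]
          gcongr
    _ ≤ n * (rho f p).toReal ^ p.toReal := by
        rw [← mul_sum]
        gcongr
        exact sum_norm_rpow_div_le_rho hp hp0 hf n

theorem isCesaroBounded_sub_one_of_top {f : ℕ → ℂ} (hf : rho f ∞ ≠ ∞) {s : ℝ} (hs : 0 ≤ s) :
    IsCesaroBounded s (rho f ∞).toReal fun j => f j - 1 := fun n => by
  refine (sum_le_card_nsmul _ _ _ fun j hj => Real.rpow_le_rpow (norm_nonneg _)
    (norm_sub_one_le_rho_top hf (mem_Icc.1 hj).1) hs).trans_eq ?_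
  rw [Nat.card_Icc, Nat.add_sub_cancel, nsmul_eq_mul]

theorem exists_isCesaroBounded_sub_one {p : ℝ≥0∞} {c : ℝ} (hc : 0 ≤ c)
    (hp : ENNReal.ofReal c < p) : ∃ s, c < s ∧ ∀ {f : ℕ → ℂ}, rho f p ≠ ∞ →
      IsCesaroBounded s (rho f p).toReal fun j => f j - 1 := by
  rcases eq_or_ne p ∞ with rfl | hpt
  · exact ⟨c + 1, lt_add_one c, fun hf => isCesaroBounded_sub_one_of_top hf (by positivity)⟩
  · have hcp := (ENNReal.ofReal_lt_iff_lt_toReal hc hpt).1 hp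
    exact ⟨p.toReal, hcp, isCesaroBounded_sub_one_of_ne_top hpt (hc.trans_lt hcp)⟩

end Rho

section Expansion

/-- The perturbation `e_j = d_j (f̂(j) - 1)` of the exponents. -/
noncomputable def perturbation (d : ℕ → ℝ) (f : ℕ → ℂ) (j : ℕ) : ℂ := d j * (f j - 1)

theorem mCoeff_eq_perturbedCoeff (d : ℕ → ℝ) (f : ℕ → ℂ) (n : ℕ) :
    mCoeff d f n = perturbedCoeff d (perturbation d f) n :=
  expCoeff_congr fun j _ => by
    rw [Pi.add_apply, perturbation]
    ring

theorem exp_lPoly_one (d : ℕ → ℝ) (f : ℕ → ℂ) (n : ℕ) :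
    Complex.exp (lPoly d f n 1) = expPartial (perturbation d f) n := by
  rw [lPoly, expPartial]
  exact congrArg _ (sum_congr rfl fun j _ => by rw [one_pow, mul_one, perturbation, mul_div_assoc])

theorem mCoeff_div_pCoeff (d : ℕ → ℝ) (f : ℕ → ℂ) (n : ℕ) :
    mCoeff d f n / pCoeff d n =
      Complex.exp (lPoly d f n 1) * normalizedCoeff d (perturbation d f) n := by
  rw [mCoeff_eq_perturbedCoeff, exp_lPoly_one, normalizedCoeff]
  have := norm_pos_iff.1 (norm_expPartial_pos (perturbation d f) n)
  field_simp

theorem isCesaroBounded_perturbation {d : ℕ → ℝ} {f : ℕ → ℂ} {b s ε : ℝ}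
    (hf : IsCesaroBounded s ε fun j => f j - 1) (hs : 0 ≤ s) (hε : 0 ≤ ε) (hb : 0 ≤ b)
    (hd : ∀ j, 1 ≤ j → |d j| ≤ b) : IsCesaroBounded s (b * ε) (perturbation d f) :=
  hf.of_norm_le_mul hs hε hb fun j hj => by
    rw [perturbation, norm_mul, Complex.norm_real, Real.norm_eq_abs]
    gcongr
    exact hd j hj

end Expansion

end VoronoiMean

theorem theorem6 (dlo dhi : ℝ) (hdlo : 0 < dlo) (p : ℝ≥0∞)
    (hp : ENNReal.ofReal (max 1 (1 / dlo)) < p) :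
    ∃ δ : ℝ, 0 < δ ∧ ∃ C : ℝ, 0 < C ∧
      ∀ d : ℕ → ℝ, (∀ j : ℕ, 1 ≤ j → dlo ≤ d j ∧ d j ≤ dhi) →
        ∀ f : ℕ → ℂ, VoronoiMean.rho f p ≤ ENNReal.ofReal δ →
          ∀ N : ℕ, ∃ R : ℂ, ‖R‖ ≤ C * (VoronoiMean.rho f p).toReal ^ 2 ∧
            VoronoiMean.mCoeff d f N / (VoronoiMean.pCoeff d N : ℂ) =
              Complex.exp (VoronoiMean.lPoly d f N 1) *
                (1 + ∑ j ∈ Finset.Icc 1 N, (d j : ℂ) * ((f j - 1) / (j : ℂ)) *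
                    (((VoronoiMean.pCoeff d (N - j) / VoronoiMean.pCoeff d N - 1 : ℝ)) : ℂ)
                  + R) := by
  have ha : 0 < min dlo 1 := lt_min hdlo one_pos
  have hinv : 1 / min dlo 1 ≤ max 1 (1 / dlo) := by
    rcases min_choice dlo 1 with h | h <;> simp [h]
  set b := max dhi 1
  have hb : 0 < b := one_pos.trans_le (le_max_right dhi 1)
  obtain ⟨s, hs, hcesaro⟩ :=
    VoronoiMean.exists_isCesaroBounded_sub_one (le_max_of_le_left zero_le_one) hp
  obtain ⟨δ, hδ, C, hC, hexpansion⟩ := VoronoiMean.exists_forall_norm_normalizedCoeff_sub_le ha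
    (min_le_right dlo 1) hb (hinv.trans_lt hs)
  refine ⟨δ / b, by positivity, C * b ^ 2, by positivity, fun d hd f hf N => ?_⟩
  have hlo (j : ℕ) (hj : 1 ≤ j) : min dlo 1 ≤ d j := min_le_of_left_le (hd j hj).1
  have hhi (j : ℕ) (hj : 1 ≤ j) : d j ≤ b := le_max_of_le_left (hd j hj).2
  have hρδ := ENNReal.toReal_le_of_le_ofReal (by positivity) hf
  have hs0 : 0 ≤ s := zero_le_one.trans ((le_max_left _ _).trans hs.le)
  have he := VoronoiMean.isCesaroBounded_perturbation
    (hcesaro (ne_top_of_le_ne_top ENNReal.ofReal_ne_top hf)) hs0 ENNReal.toReal_nonneg hb.le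
    fun j hj => (abs_of_pos (ha.trans_le (hlo j hj))).trans_le (hhi j hj)
  refine ⟨_, (hexpansion hlo hhi he (by positivity) ((le_div_iff₀' hb).1 hρδ) N).trans_eq (by ring),
    ?_⟩
  rw [VoronoiMean.mCoeff_div_pCoeff]
  simp only [VoronoiMean.perturbation, mul_div_assoc]
  ring
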